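/- **Conventions.** A *decorated bicategory* $\mathcal B$ is a bicategory together with a category $\mathcal B^*$ (the decoration, whose morphisms are called vertical) having the same objects. A *decorated pseudofunctor* $G:\mathcal B\to\mathcal B'$ is a pseudofunctor between the underlying bicategories together with a functor $G^*:\mathcal B^*\to\mathcal B'^*$ having the same object function. A *double category* is a category weakly internal to categories: vertical composition is strict, and horizontal composition is associative and unital up to globular isomorphisms that are natural with respect to all squares and satisfy the pentagon and triangle identities. A square is *globular* if its left and right edges are identities. A *double functor* is a pair of functors, on the categories of objects and on the categories of squares, strictly compatible with source and target, together with globular comparison isomorphisms for horizontal composites and horizontal identities, natural with respect to all squares and satisfying the usual coherence conditions. The *decorated horizontalization* $H^*C$ of a double category $C$ is its category of objects together with the bicategory of objects, horizontal morphisms and globular squares; a double functor $F$ induces a decorated pseudofunctor $H^*F$. For a decorated bicategory $\mathcal B$, the *formal squares* are the well-formed expressions built from the 2-cells $\varphi$ of $\mathcal B$ (as globular squares) and formal horizontal identities $i_f$ of the morphisms $f$ of $\mathcal B^*$ by formal vertical identities and by formal vertical and (bracketed) horizontal composition of compatible squares. They are filtered by $E_1\subseteq F_1\subseteq E_2\subseteq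 F_2\subseteq\cdots$, where $E_1$ consists of the horizontal words in the generators $\varphi,i_f$, $F_k$ of the vertical composites (including vertical identities) of elements of $E_k$, and $E_{k+1}$ of the horizontal words in elements of $F_k$. The *free globularly generated double category* $Q_{\mathcal B}$ has category of objects $\mathcal B^*$ and the 1-cells of $\mathcal B$ as horizontal morphisms, with the horizontal composition of 1-cells, associators and unitors of $\mathcal B$; its squares are the formal squares modulo the smallest congruence that makes vertical composition associative and unital, satisfies the exchange law, identifies formal vertical composites (and identities) of 2-cells and of horizontal identities $i_f$, and formal horizontal composites of 2-cells, with the actual ones, and makes the associators and unitors of $\mathcal B$ natural with respect to all squares. Let $V_k^{\mathcal B}$ be the set of squares of $Q_{\mathcal B}$ represented by elements of $F_k$, and let $j^{\mathcal B}:\mathcal B\to H^*Q_{\mathcal B}$ be the canonical decorated pseudofunctor, which is the identity on objects, vertical morphisms and 1-cells, sends a 2-cell to its class, and has identity coherence 2-cells. **Theorem.** Let $\mathcal B,\mathcal B'$ be decorated bicategories and let $G:\mathcal B\to\mathcal B'$ be a decorated pseudofunctor, with coherence isomorphisms $u_a:G(1_a)\to 1_{Ga}$ and $m_{\alpha,\beta}:G(\alpha\beta)\to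 G\alpha\, G\beta$ (horizontal composites in diagrammatic order). There is a unique double functor $Q_G:Q_{\mathcal B}\to Q_{\mathcal B'}$ whose decorated horizontalization restricts to $G$ on $\mathcal B$, that is, such that $$H^*Q_G\circ j^{\mathcal B}=j^{\mathcal B'}\circ G$$ as decorated pseudofunctors (coherence isomorphisms included). Moreover, $Q_G$ is induced on classes by the map $\Phi\mapsto G\Phi$ on formal squares defined recursively as follows: it sends a 2-cell $\varphi$ to $G\varphi$, and $i_f$, for $f:a\to c$, to the vertical composite of $u_a$, $i_{G^*f}$ and $u_c^{-1}$; it preserves formal vertical identities and formal vertical composites; and it sends the horizontal composite of $\Phi$ (with top $\alpha$ and bottom $\beta$) followed by $\Psi$ (with top $\alpha'$ and bottom $\beta'$) to the vertical composite of $m_{\alpha,\alpha'}$, the horizontal composite of $G\Phi$ and $G\Psi$, and $m_{\beta,\beta'}^{-1}$. Finally, $Q_G$ maps $V_k^{\mathcal B}$ into $V_k^{\mathcal B'}$ for every $k\ge 1$. -/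

import Mathlib

open CategoryTheory Bicategory

set_option linter.checkUnivs false

universe w v x u w' v' x' u' s s' w'' v'' x'' u''

namespace DoubleCats

/-! ## Decorated bicategories and decorated pseudofunctors -/

/-- A decorated bicategory: a bicategory together with a category (the decoration) having the same
collection of objects. The morphisms of the decoration are the vertical morphisms. -/
structure DecoratedBicategory where
  Obj : Type u
  [bicategory : Bicategory.{w, v} Obj]
  decoration : Category.{x} Obj

attribute [instance] DecoratedBicategory.bicategory

namespace DecoratedBicategory

variable (B : DecoratedBicategory.{w, v, x, u})

/-- Morphisms of the decoration. -/
abbrev VHom (a b : B.Obj) : Type x := @Quiver.Hom B.Obj B.decoration.toQuiver a b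

/-- Identities of the decoration. -/
abbrev vid (a : B.Obj) : B.VHom a a := @CategoryStruct.id B.Obj B.decoration.toCategoryStruct a

variable {B} in
/-- Composition in the decoration, in diagrammatic order. -/
abbrev vcomp {a b c : B.Obj} (f : B.VHom a b) (g : B.VHom b c) : B.VHom a c :=
  @CategoryStruct.comp B.Obj B.decoration.toCategoryStruct a b c f g

end DecoratedBicategory

/-- A decorated pseudofunctor: a pseudofunctor between the underlying bicategories and a functor
between the decorations, with the same object function. -/
structure DecoratedPseudofunctor (B : DecoratedBicategory.{w, v, x, u})
    (B' : DecoratedBicategory.{w', v', x', u'}) where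
  toPseudo : Pseudofunctor B.Obj B'.Obj
  vmap : ∀ {a b : B.Obj}, B.VHom a b → B'.VHom (toPseudo.obj a) (toPseudo.obj b)
  vmap_id : ∀ a : B.Obj, vmap (B.vid a) = B'.vid (toPseudo.obj a)
  vmap_comp : ∀ {a b c : B.Obj} (f : B.VHom a b) (g : B.VHom b c),
    vmap (B.vcomp f g) = B'.vcomp (vmap f) (vmap g)

/-- Composition of decorated pseudofunctors. -/
def DecoratedPseudofunctor.comp {B : DecoratedBicategory.{w, v, x, u}}
    {B' : DecoratedBicategory.{w', v', x', u'}} {B'' : DecoratedBicategory.{w'', v'', x'', u''}}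
    (F : DecoratedPseudofunctor B B') (G : DecoratedPseudofunctor B' B'') :
    DecoratedPseudofunctor B B'' where
  toPseudo := F.toPseudo.comp G.toPseudo
  vmap := fun f => G.vmap (F.vmap f)
  vmap_id := fun a => by rw [F.vmap_id, G.vmap_id]; rfl
  vmap_comp := fun f g => by rw [F.vmap_comp, G.vmap_comp]; rfl

/-! ## Double categories -/

/-- The categories and functors underlying a (pseudo) double category: the category of objects
`C₀` (objects `Obj`, vertical morphisms), the category `C₁` (objects: horizontal morphisms;
morphisms: squares, with vertical composition `vcompSq`), the source and target functors
`C₁ ⥤ C₀`, the horizontal identity functor `C₀ ⥤ C₁`, and the horizontal composition functor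
on the pullback `C₁ ×_{C₀} C₁`. A square `φ : Sq α β` has top edge `α`, bottom edge `β`, left edge
`src φ` and right edge `tgt φ`. Compositions are written in diagrammatic order. -/
structure DoubleCategoryData where
  Obj : Type u
  vert : Category.{x} Obj
  Hor : Obj → Obj → Type v
  Sq : ∀ {a b c d : Obj}, Hor a b → Hor c d → Type s
  -- vertical composition of squares
  vidSq : ∀ {a b : Obj} (α : Hor a b), Sq α α
  vcompSq : ∀ {a b c d e k : Obj} {α : Hor a b} {β : Hor c d} {γ : Hor e k},
    Sq α β → Sq β γ → Sq α γ
  vidSq_vcompSq : ∀ {a b c d : Obj} {α : Hor a b} {β : Hor c d} (φ : Sq α β),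
    vcompSq (vidSq α) φ = φ
  vcompSq_vidSq : ∀ {a b c d : Obj} {α : Hor a b} {β : Hor c d} (φ : Sq α β),
    vcompSq φ (vidSq β) = φ
  vcompSq_assoc : ∀ {a b c d e k l m : Obj} {α : Hor a b} {β : Hor c d} {γ : Hor e k}
    {δ : Hor l m} (φ : Sq α β) (ψ : Sq β γ) (χ : Sq γ δ),
    vcompSq (vcompSq φ ψ) χ = vcompSq φ (vcompSq ψ χ)
  -- source and target functors
  src : ∀ {a b c d : Obj} {α : Hor a b} {β : Hor c d},
    Sq α β → @Quiver.Hom Obj vert.toQuiver a c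
  tgt : ∀ {a b c d : Obj} {α : Hor a b} {β : Hor c d},
    Sq α β → @Quiver.Hom Obj vert.toQuiver b d
  src_vidSq : ∀ {a b : Obj} (α : Hor a b),
    src (vidSq α) = @CategoryStruct.id Obj vert.toCategoryStruct a
  tgt_vidSq : ∀ {a b : Obj} (α : Hor a b),
    tgt (vidSq α) = @CategoryStruct.id Obj vert.toCategoryStruct b
  src_vcompSq : ∀ {a b c d e k : Obj} {α : Hor a b} {β : Hor c d} {γ : Hor e k}
    (φ : Sq α β) (ψ : Sq β γ), src (vcompSq φ ψ) =
      @CategoryStruct.comp Obj vert.toCategoryStruct _ _ _ (src φ) (src ψ)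
  tgt_vcompSq : ∀ {a b c d e k : Obj} {α : Hor a b} {β : Hor c d} {γ : Hor e k}
    (φ : Sq α β) (ψ : Sq β γ), tgt (vcompSq φ ψ) =
      @CategoryStruct.comp Obj vert.toCategoryStruct _ _ _ (tgt φ) (tgt ψ)
  -- horizontal identity functor
  hid : ∀ a : Obj, Hor a a
  hidSq : ∀ {a c : Obj}, @Quiver.Hom Obj vert.toQuiver a c → Sq (hid a) (hid c)
  src_hidSq : ∀ {a c : Obj} (f : @Quiver.Hom Obj vert.toQuiver a c), src (hidSq f) = f
  tgt_hidSq : ∀ {a c : Obj} (f : @Quiver.Hom Obj vert.toQuiver a c), tgt (hidSq f) = f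
  hidSq_id : ∀ a : Obj, hidSq (@CategoryStruct.id Obj vert.toCategoryStruct a) = vidSq (hid a)
  hidSq_comp : ∀ {a c e : Obj} (f : @Quiver.Hom Obj vert.toQuiver a c)
    (g : @Quiver.Hom Obj vert.toQuiver c e),
    hidSq (@CategoryStruct.comp Obj vert.toCategoryStruct _ _ _ f g) = vcompSq (hidSq f) (hidSq g)
  -- horizontal composition functor
  hcomp : ∀ {a b c : Obj}, Hor a b → Hor b c → Hor a c
  hcompSq : ∀ {a a' a'' c c' c'' : Obj} {α : Hor a a'} {α' : Hor a' a''} {β : Hor c c'}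
    {β' : Hor c' c''} (φ : Sq α β) (ψ : Sq α' β'), tgt φ = src ψ →
    Sq (hcomp α α') (hcomp β β')
  src_hcompSq : ∀ {a a' a'' c c' c'' : Obj} {α : Hor a a'} {α' : Hor a' a''} {β : Hor c c'}
    {β' : Hor c' c''} (φ : Sq α β) (ψ : Sq α' β') (h : tgt φ = src ψ),
    src (hcompSq φ ψ h) = src φ
  tgt_hcompSq : ∀ {a a' a'' c c' c'' : Obj} {α : Hor a a'} {α' : Hor a' a''} {β : Hor c c'}
    {β' : Hor c' c''} (φ : Sq α β) (ψ : Sq α' β') (h : tgt φ = src ψ),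
    tgt (hcompSq φ ψ h) = tgt ψ
  hcompSq_vidSq : ∀ {a b c : Obj} (α : Hor a b) (β : Hor b c),
    hcompSq (vidSq α) (vidSq β) ((tgt_vidSq α).trans (src_vidSq β).symm) = vidSq (hcomp α β)
  hcompSq_vcompSq : ∀ {a a' a'' c c' c'' e e' e'' : Obj} {α : Hor a a'} {α' : Hor a' a''}
    {β : Hor c c'} {β' : Hor c' c''} {γ : Hor e e'} {γ' : Hor e' e''}
    (φ₁ : Sq α β) (φ₂ : Sq β γ) (ψ₁ : Sq α' β') (ψ₂ : Sq β' γ')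
    (h₁ : tgt φ₁ = src ψ₁) (h₂ : tgt φ₂ = src ψ₂),
    hcompSq (vcompSq φ₁ φ₂) (vcompSq ψ₁ ψ₂) (by rw [tgt_vcompSq, src_vcompSq, h₁, h₂]) =
      vcompSq (hcompSq φ₁ ψ₁ h₁) (hcompSq φ₂ ψ₂ h₂)

namespace DoubleCategoryData

variable (C : DoubleCategoryData.{v, x, u, s})

/-- Vertical morphisms. -/
abbrev VHom (a b : C.Obj) : Type x := @Quiver.Hom C.Obj C.vert.toQuiver a b

/-- Vertical identities. -/
abbrev vid (a : C.Obj) : C.VHom a a := @CategoryStruct.id C.Obj C.vert.toCategoryStruct a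

variable {C} in
/-- Composition of vertical morphisms, in diagrammatic order. -/
abbrev vcomp {a b c : C.Obj} (f : C.VHom a b) (g : C.VHom b c) : C.VHom a c :=
  @CategoryStruct.comp C.Obj C.vert.toCategoryStruct a b c f g

theorem vid_vcomp {a b : C.Obj} (f : C.VHom a b) : C.vcomp (C.vid a) f = f :=
  @Category.id_comp C.Obj C.vert _ _ f

/-- Globular squares: squares whose left and right edges are vertical identities. -/
@[ext] structure Glob {C : DoubleCategoryData.{v, x, u, s}} {a b : C.Obj} (α β : C.Hor a b) where
  sq : C.Sq α β
  src_eq : C.src sq = C.vid a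
  tgt_eq : C.tgt sq = C.vid b

/-- Horizontal morphisms from `a` to `b` and globular squares form a category under vertical
composition. -/
instance globCategory (a b : C.Obj) : Category.{s} (C.Hor a b) where
  Hom α β := Glob α β
  id α := ⟨C.vidSq α, C.src_vidSq α, C.tgt_vidSq α⟩
  comp φ ψ := ⟨C.vcompSq φ.sq ψ.sq,
    by rw [C.src_vcompSq, φ.src_eq, ψ.src_eq]; exact C.vid_vcomp _,
    by rw [C.tgt_vcompSq, φ.tgt_eq, ψ.tgt_eq]; exact C.vid_vcomp _⟩
  id_comp φ := Glob.ext (C.vidSq_vcompSq φ.sq)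
  comp_id φ := Glob.ext (C.vcompSq_vidSq φ.sq)
  assoc φ ψ χ := Glob.ext (C.vcompSq_assoc φ.sq ψ.sq χ.sq)

variable {C}

@[ext] theorem glob_ext {a b : C.Obj} {α β : C.Hor a b} {φ ψ : α ⟶ β} (h : φ.sq = ψ.sq) : φ = ψ :=
  Glob.ext h

@[simp] theorem id_sq {a b : C.Obj} (α : C.Hor a b) : Glob.sq (𝟙 α) = C.vidSq α := rfl

@[simp] theorem comp_sq {a b : C.Obj} {α β γ : C.Hor a b} (φ : α ⟶ β) (ψ : β ⟶ γ) :
    Glob.sq (φ ≫ ψ) = C.vcompSq φ.sq ψ.sq := rfl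

variable (C) in
/-- The identity globular square, i.e. `𝟙 α` in `C.globCategory a b`. -/
abbrev globId {a b : C.Obj} (α : C.Hor a b) :
    @Quiver.Hom (C.Hor a b) (C.globCategory a b).toQuiver α α :=
  @CategoryStruct.id (C.Hor a b) (C.globCategory a b).toCategoryStruct α

variable (C) in
/-- Vertical composition of globular squares, i.e. `φ ≫ ψ` in `C.globCategory a b`. -/
abbrev globVcomp {a b : C.Obj} {α β γ : C.Hor a b}
    (φ : @Quiver.Hom (C.Hor a b) (C.globCategory a b).toQuiver α β)
    (ψ : @Quiver.Hom (C.Hor a b) (C.globCategory a b).toQuiver β γ) :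
    @Quiver.Hom (C.Hor a b) (C.globCategory a b).toQuiver α γ :=
  @CategoryStruct.comp (C.Hor a b) (C.globCategory a b).toCategoryStruct _ _ _ φ ψ

/-- Horizontal composition of globular squares. -/
def globComp {a b c : C.Obj} {α β : C.Hor a b} {α' β' : C.Hor b c} (φ : α ⟶ β) (ψ : α' ⟶ β') :
    C.hcomp α α' ⟶ C.hcomp β β' :=
  ⟨C.hcompSq φ.sq ψ.sq (φ.tgt_eq.trans ψ.src_eq.symm),
    (C.src_hcompSq _ _ _).trans φ.src_eq, (C.tgt_hcompSq _ _ _).trans ψ.tgt_eq⟩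

end DoubleCategoryData

open DoubleCategoryData

namespace DoubleCategoryData

variable {C : DoubleCategoryData.{v, x, u, s}}

theorem id_globVcomp {a b : C.Obj} {α β : C.Hor a b} (φ : α ⟶ β) :
    C.globVcomp (C.globId α) φ = φ := Category.id_comp φ

theorem globVcomp_id {a b : C.Obj} {α β : C.Hor a b} (φ : α ⟶ β) :
    C.globVcomp φ (C.globId β) = φ := Category.comp_id φ

theorem globComp_globId {a b c : C.Obj} (α : C.Hor a b) (β : C.Hor b c) :
    globComp (C.globId α) (C.globId β) = C.globId (C.hcomp α β) :=
  Glob.ext (C.hcompSq_vidSq α β)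

end DoubleCategoryData

/-- A double category (category weakly internal to categories): vertical composition is strict,
horizontal composition is associative and unital up to globular isomorphisms that are natural
with respect to all squares and satisfy the pentagon and triangle identities. -/
structure DoubleCategory where
  data : DoubleCategoryData.{v, x, u, s}
  associator : ∀ {a b c d : data.Obj} (α : data.Hor a b) (β : data.Hor b c) (γ : data.Hor c d),
    data.hcomp (data.hcomp α β) γ ≅ data.hcomp α (data.hcomp β γ)
  leftUnitor : ∀ {a b : data.Obj} (α : data.Hor a b), data.hcomp (data.hid a) α ≅ α
  rightUnitor : ∀ {a b : data.Obj} (α : data.Hor a b), data.hcomp α (data.hid b) ≅ α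
  associator_naturality : ∀ {a b c d a' b' c' d' : data.Obj}
    {α : data.Hor a b} {β : data.Hor b c} {γ : data.Hor c d}
    {α' : data.Hor a' b'} {β' : data.Hor b' c'} {γ' : data.Hor c' d'}
    (φ : data.Sq α α') (ψ : data.Sq β β') (χ : data.Sq γ γ')
    (h : data.tgt φ = data.src ψ) (h' : data.tgt ψ = data.src χ),
    data.vcompSq (data.hcompSq (data.hcompSq φ ψ h) χ ((data.tgt_hcompSq φ ψ h).trans h'))
        (associator α' β' γ').hom.sq =
      data.vcompSq (associator α β γ).hom.sq
        (data.hcompSq φ (data.hcompSq ψ χ h') (h.trans (data.src_hcompSq ψ χ h').symm))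
  leftUnitor_naturality : ∀ {a b c d : data.Obj} {α : data.Hor a b} {β : data.Hor c d}
    (φ : data.Sq α β),
    data.vcompSq (data.hcompSq (data.hidSq (data.src φ)) φ (data.tgt_hidSq (data.src φ)))
        (leftUnitor β).hom.sq =
      data.vcompSq (leftUnitor α).hom.sq φ
  rightUnitor_naturality : ∀ {a b c d : data.Obj} {α : data.Hor a b} {β : data.Hor c d}
    (φ : data.Sq α β),
    data.vcompSq (data.hcompSq φ (data.hidSq (data.tgt φ)) (data.src_hidSq (data.tgt φ)).symm)
        (rightUnitor β).hom.sq =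
      data.vcompSq (rightUnitor α).hom.sq φ
  pentagon : ∀ {a b c d e : data.Obj} (α : data.Hor a b) (β : data.Hor b c) (γ : data.Hor c d)
    (δ : data.Hor d e),
    globComp (associator α β γ).hom (𝟙 δ) ≫ (associator α (data.hcomp β γ) δ).hom ≫
        globComp (𝟙 α) (associator β γ δ).hom =
      (associator (data.hcomp α β) γ δ).hom ≫ (associator α β (data.hcomp γ δ)).hom
  triangle : ∀ {a b c : data.Obj} (α : data.Hor a b) (β : data.Hor b c),
    (associator α (data.hid b) β).hom ≫ globComp (𝟙 α) (leftUnitor β).hom =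
      globComp (rightUnitor α).hom (𝟙 β)

/-- A double functor between double categories: functors between the categories of objects and
between the categories of horizontal morphisms and squares, strictly compatible with source and
target, together with globular isomorphisms comparing horizontal composites and horizontal
identities, natural with respect to all squares and satisfying the usual coherence conditions. -/
structure DoubleFunctor (C : DoubleCategory.{v, x, u, s}) (D : DoubleCategory.{v', x', u', s'})
    where
  obj : C.data.Obj → D.data.Obj
  vmap : ∀ {a b : C.data.Obj}, C.data.VHom a b → D.data.VHom (obj a) (obj b)
  vmap_id : ∀ a : C.data.Obj, vmap (C.data.vid a) = D.data.vid (obj a)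
  vmap_comp : ∀ {a b c : C.data.Obj} (f : C.data.VHom a b) (g : C.data.VHom b c),
    vmap (C.data.vcomp f g) = D.data.vcomp (vmap f) (vmap g)
  hmap : ∀ {a b : C.data.Obj}, C.data.Hor a b → D.data.Hor (obj a) (obj b)
  sqmap : ∀ {a b c d : C.data.Obj} {α : C.data.Hor a b} {β : C.data.Hor c d},
    C.data.Sq α β → D.data.Sq (hmap α) (hmap β)
  src_sqmap : ∀ {a b c d : C.data.Obj} {α : C.data.Hor a b} {β : C.data.Hor c d}
    (φ : C.data.Sq α β), D.data.src (sqmap φ) = vmap (C.data.src φ)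
  tgt_sqmap : ∀ {a b c d : C.data.Obj} {α : C.data.Hor a b} {β : C.data.Hor c d}
    (φ : C.data.Sq α β), D.data.tgt (sqmap φ) = vmap (C.data.tgt φ)
  sqmap_vidSq : ∀ {a b : C.data.Obj} (α : C.data.Hor a b),
    sqmap (C.data.vidSq α) = D.data.vidSq (hmap α)
  sqmap_vcompSq : ∀ {a b c d e k : C.data.Obj} {α : C.data.Hor a b} {β : C.data.Hor c d}
    {γ : C.data.Hor e k} (φ : C.data.Sq α β) (ψ : C.data.Sq β γ),
    sqmap (C.data.vcompSq φ ψ) = D.data.vcompSq (sqmap φ) (sqmap ψ)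
  mapId : ∀ a : C.data.Obj, hmap (C.data.hid a) ≅ D.data.hid (obj a)
  mapComp : ∀ {a b c : C.data.Obj} (α : C.data.Hor a b) (β : C.data.Hor b c),
    hmap (C.data.hcomp α β) ≅ D.data.hcomp (hmap α) (hmap β)
  mapId_naturality : ∀ {a c : C.data.Obj} (f : C.data.VHom a c),
    D.data.vcompSq (sqmap (C.data.hidSq f)) (mapId c).hom.sq =
      D.data.vcompSq (mapId a).hom.sq (D.data.hidSq (vmap f))
  mapComp_naturality : ∀ {a a' a'' c c' c'' : C.data.Obj} {α : C.data.Hor a a'}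
    {α' : C.data.Hor a' a''} {β : C.data.Hor c c'} {β' : C.data.Hor c' c''}
    (φ : C.data.Sq α β) (ψ : C.data.Sq α' β') (h : C.data.tgt φ = C.data.src ψ),
    D.data.vcompSq (sqmap (C.data.hcompSq φ ψ h)) (mapComp β β').hom.sq =
      D.data.vcompSq (mapComp α α').hom.sq
        (D.data.hcompSq (sqmap φ) (sqmap ψ) (by rw [tgt_sqmap, src_sqmap, h]))
  map_associator : ∀ {a b c d : C.data.Obj} (α : C.data.Hor a b) (β : C.data.Hor b c)
    (γ : C.data.Hor c d),
    D.data.vcompSq (sqmap (C.associator α β γ).hom.sq)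
        ((mapComp α (C.data.hcomp β γ)).hom ≫ globComp (𝟙 (hmap α)) (mapComp β γ).hom).sq =
      ((mapComp (C.data.hcomp α β) γ).hom ≫ globComp (mapComp α β).hom (𝟙 (hmap γ)) ≫
        (D.associator (hmap α) (hmap β) (hmap γ)).hom).sq
  map_leftUnitor : ∀ {a b : C.data.Obj} (α : C.data.Hor a b),
    sqmap (C.leftUnitor α).hom.sq =
      ((mapComp (C.data.hid a) α).hom ≫ globComp (mapId a).hom (𝟙 (hmap α)) ≫
        (D.leftUnitor (hmap α)).hom).sq
  map_rightUnitor : ∀ {a b : C.data.Obj} (α : C.data.Hor a b),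
    sqmap (C.rightUnitor α).hom.sq =
      ((mapComp α (C.data.hid b)).hom ≫ globComp (𝟙 (hmap α)) (mapId b).hom ≫
        (D.rightUnitor (hmap α)).hom).sq

/-! ## Decorated horizontalization -/

namespace DoubleCategory

variable {C : DoubleCategory.{v, x, u, s}} {a b c d : C.data.Obj}

theorem globComp_id (α : C.data.Hor a b) (β : C.data.Hor b c) :
    globComp (𝟙 α) (𝟙 β) = 𝟙 (C.data.hcomp α β) :=
  glob_ext (C.data.hcompSq_vidSq α β)

theorem globComp_comp {α β γ : C.data.Hor a b} {α' β' γ' : C.data.Hor b c} (φ : α ⟶ β) (φ' : β ⟶ γ)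
    (ψ : α' ⟶ β') (ψ' : β' ⟶ γ') :
    globComp (φ ≫ φ') (ψ ≫ ψ') = globComp φ ψ ≫ globComp φ' ψ' :=
  glob_ext (C.data.hcompSq_vcompSq φ.sq φ'.sq ψ.sq ψ'.sq _ _)

theorem globComp_associator {α α' : C.data.Hor a b} {β β' : C.data.Hor b c} {γ γ' : C.data.Hor c d}
    (φ : α ⟶ α') (ψ : β ⟶ β') (χ : γ ⟶ γ') :
    globComp (globComp φ ψ) χ ≫ (C.associator α' β' γ').hom =
      (C.associator α β γ).hom ≫ globComp φ (globComp ψ χ) :=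
  glob_ext (C.associator_naturality φ.sq ψ.sq χ.sq _ _)

theorem globComp_leftUnitor {α β : C.data.Hor a b} (φ : α ⟶ β) :
    globComp (𝟙 (C.data.hid a)) φ ≫ (C.leftUnitor β).hom = (C.leftUnitor α).hom ≫ φ := by
  apply glob_ext
  refine Eq.trans ?_ (C.leftUnitor_naturality φ.sq)
  simp only [comp_sq, globComp, id_sq, φ.src_eq, C.data.hidSq_id]

theorem globComp_rightUnitor {α β : C.data.Hor a b} (φ : α ⟶ β) :
    globComp φ (𝟙 (C.data.hid b)) ≫ (C.rightUnitor β).hom = (C.rightUnitor α).hom ≫ φ := by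
  apply glob_ext
  refine Eq.trans ?_ (C.rightUnitor_naturality φ.sq)
  simp only [comp_sq, globComp, id_sq, φ.tgt_eq, C.data.hidSq_id]

theorem whiskerLeft_comp' (α : C.data.Hor a b) {β γ δ : C.data.Hor b c} (φ : β ⟶ γ) (ψ : γ ⟶ δ) :
    globComp (𝟙 α) (φ ≫ ψ) = globComp (𝟙 α) φ ≫ globComp (𝟙 α) ψ := by
  rw [← globComp_comp, Category.comp_id]

theorem comp_whiskerRight' (α : C.data.Hor b c) {β γ δ : C.data.Hor a b} (φ : β ⟶ γ) (ψ : γ ⟶ δ) :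
    globComp (φ ≫ ψ) (𝟙 α) = globComp φ (𝟙 α) ≫ globComp ψ (𝟙 α) := by
  rw [← globComp_comp, Category.comp_id]

theorem id_whiskerLeft' {α β : C.data.Hor a b} (φ : α ⟶ β) :
    globComp (𝟙 (C.data.hid a)) φ = (C.leftUnitor α).hom ≫ φ ≫ (C.leftUnitor β).inv := by
  rw [← Category.assoc, Iso.eq_comp_inv, globComp_leftUnitor]

theorem whiskerRight_id' {α β : C.data.Hor a b} (φ : α ⟶ β) :
    globComp φ (𝟙 (C.data.hid b)) = (C.rightUnitor α).hom ≫ φ ≫ (C.rightUnitor β).inv := by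
  rw [← Category.assoc, Iso.eq_comp_inv, globComp_rightUnitor]

theorem comp_whiskerLeft' (α : C.data.Hor a b) (β : C.data.Hor b c) {γ γ' : C.data.Hor c d}
    (φ : γ ⟶ γ') : globComp (𝟙 (C.data.hcomp α β)) φ =
      (C.associator α β γ).hom ≫ globComp (𝟙 α) (globComp (𝟙 β) φ) ≫
        (C.associator α β γ').inv := by
  rw [← Category.assoc, Iso.eq_comp_inv, ← globComp_associator, globComp_id]

theorem whiskerRight_comp' {α α' : C.data.Hor a b} (φ : α ⟶ α') (β : C.data.Hor b c)
    (γ : C.data.Hor c d) : globComp φ (𝟙 (C.data.hcomp β γ)) =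
      (C.associator α β γ).inv ≫ globComp (globComp φ (𝟙 β)) (𝟙 γ) ≫
        (C.associator α' β γ).hom := by
  rw [globComp_associator, globComp_id, Iso.inv_hom_id_assoc]

theorem whisker_assoc' (α : C.data.Hor a b) {β β' : C.data.Hor b c} (φ : β ⟶ β')
    (γ : C.data.Hor c d) : globComp (globComp (𝟙 α) φ) (𝟙 γ) =
      (C.associator α β γ).hom ≫ globComp (𝟙 α) (globComp φ (𝟙 γ)) ≫
        (C.associator α β' γ).inv := by
  rw [← Category.assoc, Iso.eq_comp_inv, globComp_associator]

theorem whisker_exchange' {α α' : C.data.Hor a b} {β β' : C.data.Hor b c} (φ : α ⟶ α')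
    (ψ : β ⟶ β') : globComp (𝟙 α) ψ ≫ globComp φ (𝟙 β') =
      globComp φ (𝟙 β) ≫ globComp (𝟙 α') ψ := by
  rw [← globComp_comp, ← globComp_comp]
  simp only [Category.comp_id, Category.id_comp]

/-- The horizontal bicategory: objects, horizontal morphisms and globular squares. -/
abbrev horizontalBicategory (C : DoubleCategory.{v, x, u, s}) : Bicategory.{s, v} C.data.Obj where
  Hom a b := C.data.Hor a b
  id a := C.data.hid a
  comp α β := C.data.hcomp α β
  homCategory a b := C.data.globCategory a b
  whiskerLeft α _ _ φ := globComp (𝟙 α) φ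
  whiskerRight φ α := globComp φ (𝟙 α)
  associator α β γ := C.associator α β γ
  leftUnitor α := C.leftUnitor α
  rightUnitor α := C.rightUnitor α
  whiskerLeft_id α β := globComp_id α β
  whiskerLeft_comp α _ _ _ φ ψ := whiskerLeft_comp' α φ ψ
  id_whiskerLeft φ := id_whiskerLeft' φ
  comp_whiskerLeft α β _ _ φ := comp_whiskerLeft' α β φ
  id_whiskerRight α β := globComp_id α β
  comp_whiskerRight φ ψ α := comp_whiskerRight' α φ ψ
  whiskerRight_id φ := whiskerRight_id' φ
  whiskerRight_comp φ α β := whiskerRight_comp' φ α β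
  whisker_assoc α _ _ φ β := whisker_assoc' α φ β
  whisker_exchange φ ψ := whisker_exchange' φ ψ
  pentagon α β γ δ := C.pentagon α β γ δ
  triangle α β := C.triangle α β

/-- The decorated horizontalization: the category of objects together with the horizontal
bicategory. -/
def horizontalization (C : DoubleCategory.{v, x, u, s}) : DecoratedBicategory.{s, v, x, u} where
  Obj := C.data.Obj
  bicategory := C.horizontalBicategory
  decoration := C.data.vert

end DoubleCategory

namespace DoubleFunctor

variable {C : DoubleCategory.{v, x, u, s}} {D : DoubleCategory.{v', x', u', s'}}
  (F : DoubleFunctor C D) {a b c d : C.data.Obj}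

/-- The action of a double functor on globular squares. -/
def globMap {α β : C.data.Hor a b} (φ : α ⟶ β) : F.hmap α ⟶ F.hmap β :=
  ⟨F.sqmap φ.sq, by rw [F.src_sqmap, φ.src_eq, F.vmap_id], by rw [F.tgt_sqmap, φ.tgt_eq, F.vmap_id]⟩

theorem globMap_id (α : C.data.Hor a b) : F.globMap (𝟙 α) = 𝟙 (F.hmap α) :=
  glob_ext (F.sqmap_vidSq α)

theorem globMap_comp {α β γ : C.data.Hor a b} (φ : α ⟶ β) (ψ : β ⟶ γ) :
    F.globMap (φ ≫ ψ) = F.globMap φ ≫ F.globMap ψ :=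
  glob_ext (F.sqmap_vcompSq φ.sq ψ.sq)

theorem globMap_globComp {α β : C.data.Hor a b} {α' β' : C.data.Hor b c}
    (φ : α ⟶ β) (ψ : α' ⟶ β') :
    F.globMap (globComp φ ψ) ≫ (F.mapComp β β').hom =
      (F.mapComp α α').hom ≫ globComp (F.globMap φ) (F.globMap ψ) :=
  glob_ext (F.mapComp_naturality φ.sq ψ.sq _)

theorem globMap_whiskerLeft (α : C.data.Hor a b) {β γ : C.data.Hor b c} (φ : β ⟶ γ) :
    F.globMap (globComp (𝟙 α) φ) = (F.mapComp α β).hom ≫ globComp (𝟙 (F.hmap α)) (F.globMap φ) ≫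
      (F.mapComp α γ).inv := by
  rw [← Category.assoc, Iso.eq_comp_inv, globMap_globComp, globMap_id]

theorem globMap_whiskerRight {β γ : C.data.Hor a b} (φ : β ⟶ γ) (α : C.data.Hor b c) :
    F.globMap (globComp φ (𝟙 α)) = (F.mapComp β α).hom ≫ globComp (F.globMap φ) (𝟙 (F.hmap α)) ≫
      (F.mapComp γ α).inv := by
  rw [← Category.assoc, Iso.eq_comp_inv, globMap_globComp, globMap_id]

theorem globMap_associator (α : C.data.Hor a b) (β : C.data.Hor b c) (γ : C.data.Hor c d) :
    F.globMap (C.associator α β γ).hom =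
      (F.mapComp (C.data.hcomp α β) γ).hom ≫ globComp (F.mapComp α β).hom (𝟙 (F.hmap γ)) ≫
        (D.associator (F.hmap α) (F.hmap β) (F.hmap γ)).hom ≫
          globComp (𝟙 (F.hmap α)) (F.mapComp β γ).inv ≫ (F.mapComp α (C.data.hcomp β γ)).inv := by
  have h : F.globMap (C.associator α β γ).hom ≫ (F.mapComp α (C.data.hcomp β γ)).hom ≫
        globComp (𝟙 (F.hmap α)) (F.mapComp β γ).hom =
      (F.mapComp (C.data.hcomp α β) γ).hom ≫ globComp (F.mapComp α β).hom (𝟙 (F.hmap γ)) ≫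
        (D.associator (F.hmap α) (F.hmap β) (F.hmap γ)).hom :=
    glob_ext (F.map_associator α β γ)
  have h' : globComp (𝟙 (F.hmap α)) (F.mapComp β γ).hom ≫
      globComp (𝟙 (F.hmap α)) (F.mapComp β γ).inv = 𝟙 _ := by
    rw [← DoubleCategory.whiskerLeft_comp', Iso.hom_inv_id, DoubleCategory.globComp_id]
  have h'' := congrArg (fun t => t ≫ globComp (𝟙 (F.hmap α)) (F.mapComp β γ).inv ≫
    (F.mapComp α (C.data.hcomp β γ)).inv) h
  simp only [Category.assoc] at h''
  rw [← h'', ← Category.assoc (globComp (𝟙 (F.hmap α)) (F.mapComp β γ).hom), h',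
    Category.id_comp, Iso.hom_inv_id, Category.comp_id]

/-- The decorated horizontalization of a double functor. -/
def horizontalization : DecoratedPseudofunctor C.horizontalization D.horizontalization where
  toPseudo := letI := C.horizontalBicategory; letI := D.horizontalBicategory
    { obj := F.obj
      map := fun α => F.hmap α
      map₂ := fun φ => F.globMap φ
      map₂_id := fun α => F.globMap_id α
      map₂_comp := fun φ ψ => F.globMap_comp φ ψ
      mapId := fun a => F.mapId a
      mapComp := fun α β => F.mapComp α β
      map₂_whisker_left := fun α _ _ φ => F.globMap_whiskerLeft α φ
      map₂_whisker_right := fun φ α => F.globMap_whiskerRight φ α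
      map₂_associator := fun α β γ => F.globMap_associator α β γ
      map₂_left_unitor := fun α => glob_ext (F.map_leftUnitor α)
      map₂_right_unitor := fun α => glob_ext (F.map_rightUnitor α) }
  vmap f := F.vmap f
  vmap_id a := F.vmap_id a
  vmap_comp f g := F.vmap_comp f g

end DoubleFunctor

/-! ## The free globularly generated double category -/

/-- Formal expressions, with top edge and bottom edge recorded in the type, built from the
generators (the 2-cells `cell η` and the formal horizontal identities `hid f` of vertical morphisms)
by formal vertical identities and by formal vertical and horizontal composition. No compatibility of
left and right edges is imposed yet; see `PreSquare.WF`. -/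
inductive PreSquare (B : DecoratedBicategory.{w, v, x, u}) :
    ∀ {a b c d : B.Obj}, (a ⟶ b) → (c ⟶ d) → Type (max u v w x)
  | cell {a b : B.Obj} {α β : a ⟶ b} (η : α ⟶ β) : PreSquare B α β
  | hid {a c : B.Obj} (f : B.VHom a c) : PreSquare B (𝟙 a) (𝟙 c)
  | vid {a b : B.Obj} (α : a ⟶ b) : PreSquare B α α
  | vcomp {a b c d e k : B.Obj} {α : a ⟶ b} {β : c ⟶ d} {γ : e ⟶ k}
      (φ : PreSquare B α β) (ψ : PreSquare B β γ) : PreSquare B α γ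
  | hcomp {a a' a'' c c' c'' : B.Obj} {α : a ⟶ a'} {α' : a' ⟶ a''} {β : c ⟶ c'} {β' : c' ⟶ c''}
      (φ : PreSquare B α β) (ψ : PreSquare B α' β') : PreSquare B (α ≫ α') (β ≫ β')

namespace PreSquare

variable {B : DecoratedBicategory.{w, v, x, u}}

/-- Left edge. -/
def src : ∀ {a b c d : B.Obj} {α : a ⟶ b} {β : c ⟶ d}, PreSquare B α β → B.VHom a c
  | _, _, _, _, _, _, cell (a := a) _ => B.vid a
  | _, _, _, _, _, _, hid f => f
  | _, _, _, _, _, _, vid (a := a) _ => B.vid a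
  | _, _, _, _, _, _, vcomp φ ψ => B.vcomp φ.src ψ.src
  | _, _, _, _, _, _, hcomp φ _ => φ.src

/-- Right edge. -/
def tgt : ∀ {a b c d : B.Obj} {α : a ⟶ b} {β : c ⟶ d}, PreSquare B α β → B.VHom b d
  | _, _, _, _, _, _, cell (b := b) _ => B.vid b
  | _, _, _, _, _, _, hid f => f
  | _, _, _, _, _, _, vid (b := b) _ => B.vid b
  | _, _, _, _, _, _, vcomp φ ψ => B.vcomp φ.tgt ψ.tgt
  | _, _, _, _, _, _, hcomp _ ψ => ψ.tgt

/-- An expression is well formed if all horizontal compositions occurring in it are compatible. -/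
def WF : ∀ {a b c d : B.Obj} {α : a ⟶ b} {β : c ⟶ d}, PreSquare B α β → Prop
  | _, _, _, _, _, _, cell _ => True
  | _, _, _, _, _, _, hid _ => True
  | _, _, _, _, _, _, vid _ => True
  | _, _, _, _, _, _, vcomp φ ψ => φ.WF ∧ ψ.WF
  | _, _, _, _, _, _, hcomp φ ψ => φ.WF ∧ ψ.WF ∧ φ.tgt = ψ.src

end PreSquare

/-- Formal squares: well formed formal expressions. -/
def FormalSquare (B : DecoratedBicategory.{w, v, x, u}) {a b c d : B.Obj} (α : a ⟶ b) (β : c ⟶ d) :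
    Type (max u v w x) :=
  {φ : PreSquare B α β // φ.WF}

namespace FormalSquare

variable {B : DecoratedBicategory.{w, v, x, u}}

/-- Left edge. -/
def src {a b c d : B.Obj} {α : a ⟶ b} {β : c ⟶ d} (φ : FormalSquare B α β) : B.VHom a c := φ.1.src

/-- Right edge. -/
def tgt {a b c d : B.Obj} {α : a ⟶ b} {β : c ⟶ d} (φ : FormalSquare B α β) : B.VHom b d := φ.1.tgt

/-- The formal square of a 2-cell. -/
def cell {a b : B.Obj} {α β : a ⟶ b} (η : α ⟶ β) : FormalSquare B α β := ⟨.cell η, trivial⟩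

/-- The formal horizontal identity of a vertical morphism. -/
def hid {a c : B.Obj} (f : B.VHom a c) : FormalSquare B (𝟙 a) (𝟙 c) := ⟨.hid f, trivial⟩

/-- The formal vertical identity. -/
def vid {a b : B.Obj} (α : a ⟶ b) : FormalSquare B α α := ⟨.vid α, trivial⟩

/-- Formal vertical composition. -/
def vcomp {a b c d e k : B.Obj} {α : a ⟶ b} {β : c ⟶ d} {γ : e ⟶ k}
    (φ : FormalSquare B α β) (ψ : FormalSquare B β γ) : FormalSquare B α γ :=
  ⟨.vcomp φ.1 ψ.1, φ.2, ψ.2⟩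

/-- Formal horizontal composition of compatible formal squares. -/
def hcomp {a a' a'' c c' c'' : B.Obj} {α : a ⟶ a'} {α' : a' ⟶ a''} {β : c ⟶ c'} {β' : c' ⟶ c''}
    (φ : FormalSquare B α β) (ψ : FormalSquare B α' β') (h : φ.tgt = ψ.src) :
    FormalSquare B (α ≫ α') (β ≫ β') :=
  ⟨.hcomp φ.1 ψ.1, φ.2, ψ.2, h⟩

/-- The generators: 2-cells and formal horizontal identities of vertical morphisms. -/
inductive IsGenerator : ∀ ⦃a b c d : B.Obj⦄ ⦃α : a ⟶ b⦄ ⦃β : c ⟶ d⦄, FormalSquare B α β → Prop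
  | cell {a b : B.Obj} {α β : a ⟶ b} (η : α ⟶ β) : IsGenerator (cell η)
  | hid {a c : B.Obj} (f : B.VHom a c) : IsGenerator (hid f)

/-- Bracketed horizontal words in formal squares satisfying `P`. -/
inductive HWord
    (P : ∀ ⦃a b c d : B.Obj⦄ ⦃α : a ⟶ b⦄ ⦃β : c ⟶ d⦄, FormalSquare B α β → Prop) :
    ∀ ⦃a b c d : B.Obj⦄ ⦃α : a ⟶ b⦄ ⦃β : c ⟶ d⦄, FormalSquare B α β → Prop
  | of {a b c d : B.Obj} {α : a ⟶ b} {β : c ⟶ d} (φ : FormalSquare B α β) (h : P φ) : HWord P φ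
  | hcomp {a a' a'' c c' c'' : B.Obj} {α : a ⟶ a'} {α' : a' ⟶ a''} {β : c ⟶ c'} {β' : c' ⟶ c''}
      (φ : FormalSquare B α β) (ψ : FormalSquare B α' β') (h : φ.tgt = ψ.src)
      (hφ : HWord P φ) (hψ : HWord P ψ) : HWord P (hcomp φ ψ h)

/-- Vertical composites of formal squares satisfying `P`. -/
inductive VPath
    (P : ∀ ⦃a b c d : B.Obj⦄ ⦃α : a ⟶ b⦄ ⦃β : c ⟶ d⦄, FormalSquare B α β → Prop) :
    ∀ ⦃a b c d : B.Obj⦄ ⦃α : a ⟶ b⦄ ⦃β : c ⟶ d⦄, FormalSquare B α β → Prop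
  | of {a b c d : B.Obj} {α : a ⟶ b} {β : c ⟶ d} (φ : FormalSquare B α β) (h : P φ) : VPath P φ
  | vid {a b : B.Obj} (α : a ⟶ b) : VPath P (vid α)
  | vcomp {a b c d e k : B.Obj} {α : a ⟶ b} {β : c ⟶ d} {γ : e ⟶ k}
      (φ : FormalSquare B α β) (ψ : FormalSquare B β γ)
      (hφ : VPath P φ) (hψ : VPath P ψ) : VPath P (vcomp φ ψ)

/-- The filtration `E` of the formal squares, indexed from `0`: the first stage consists of the
horizontal words in generators, and each later stage of the horizontal words in vertical composites
of squares of the preceding stage. -/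
def InE : ℕ → ∀ ⦃a b c d : B.Obj⦄ ⦃α : a ⟶ b⦄ ⦃β : c ⟶ d⦄, FormalSquare B α β → Prop
  | 0 => HWord IsGenerator
  | k + 1 => HWord (VPath (InE k))

/-- The filtration `F` of the formal squares, indexed from `0`: vertical composites of squares in
the stage of the same index of the filtration `E`. -/
def InF (k : ℕ) : ∀ ⦃a b c d : B.Obj⦄ ⦃α : a ⟶ b⦄ ⦃β : c ⟶ d⦄, FormalSquare B α β → Prop :=
  VPath (InE k)

/-- The congruence on formal squares whose quotient is the free globularly generated double
category. -/
inductive Rel : ∀ {a b c d : B.Obj} {α : a ⟶ b} {β : c ⟶ d},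
    FormalSquare B α β → FormalSquare B α β → Prop
  -- equivalence relation compatible with both compositions
  | refl {a b c d : B.Obj} {α : a ⟶ b} {β : c ⟶ d} (φ : FormalSquare B α β) : Rel φ φ
  | symm {a b c d : B.Obj} {α : a ⟶ b} {β : c ⟶ d} {φ ψ : FormalSquare B α β} : Rel φ ψ → Rel ψ φ
  | trans {a b c d : B.Obj} {α : a ⟶ b} {β : c ⟶ d} {φ ψ χ : FormalSquare B α β} :
      Rel φ ψ → Rel ψ χ → Rel φ χ
  | vcomp_congr {a b c d e k : B.Obj} {α : a ⟶ b} {β : c ⟶ d} {γ : e ⟶ k}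
      {φ φ' : FormalSquare B α β} {ψ ψ' : FormalSquare B β γ} :
      Rel φ φ' → Rel ψ ψ' → Rel (vcomp φ ψ) (vcomp φ' ψ')
  | hcomp_congr {a a' a'' c c' c'' : B.Obj} {α : a ⟶ a'} {α' : a' ⟶ a''} {β : c ⟶ c'}
      {β' : c' ⟶ c''} {φ φ' : FormalSquare B α β} {ψ ψ' : FormalSquare B α' β'}
      (h : φ.tgt = ψ.src) (h' : φ'.tgt = ψ'.src) :
      Rel φ φ' → Rel ψ ψ' → Rel (hcomp φ ψ h) (hcomp φ' ψ' h')
  -- formal vertical composition is the composition of a free category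
  | vid_vcomp {a b c d : B.Obj} {α : a ⟶ b} {β : c ⟶ d} (φ : FormalSquare B α β) :
      Rel (vcomp (vid α) φ) φ
  | vcomp_vid {a b c d : B.Obj} {α : a ⟶ b} {β : c ⟶ d} (φ : FormalSquare B α β) :
      Rel (vcomp φ (vid β)) φ
  | vcomp_assoc {a b c d e k l m : B.Obj} {α : a ⟶ b} {β : c ⟶ d} {γ : e ⟶ k} {δ : l ⟶ m}
      (φ : FormalSquare B α β) (ψ : FormalSquare B β γ) (χ : FormalSquare B γ δ) :
      Rel (vcomp (vcomp φ ψ) χ) (vcomp φ (vcomp ψ χ))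
  -- exchange law
  | exchange {a a' a'' c c' c'' e e' e'' : B.Obj} {α : a ⟶ a'} {α' : a' ⟶ a''}
      {β : c ⟶ c'} {β' : c' ⟶ c''} {γ : e ⟶ e'} {γ' : e' ⟶ e''}
      (φ₁ : FormalSquare B α β) (φ₂ : FormalSquare B β γ)
      (ψ₁ : FormalSquare B α' β') (ψ₂ : FormalSquare B β' γ')
      (h₁ : φ₁.tgt = ψ₁.src) (h₂ : φ₂.tgt = ψ₂.src)
      (h : (vcomp φ₁ φ₂).tgt = (vcomp ψ₁ ψ₂).src) :
      Rel (hcomp (vcomp φ₁ φ₂) (vcomp ψ₁ ψ₂) h) (vcomp (hcomp φ₁ ψ₁ h₁) (hcomp φ₂ ψ₂ h₂))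
  -- vertical identities and vertical composites of generators
  | cell_id {a b : B.Obj} (α : a ⟶ b) : Rel (cell (𝟙 α)) (vid α)
  | cell_comp {a b : B.Obj} {α β γ : a ⟶ b} (η : α ⟶ β) (θ : β ⟶ γ) :
      Rel (vcomp (cell η) (cell θ)) (cell (η ≫ θ))
  | hid_id (a : B.Obj) : Rel (hid (B.vid a)) (vid (𝟙 a))
  | hid_comp {a c e : B.Obj} (f : B.VHom a c) (g : B.VHom c e) :
      Rel (vcomp (hid f) (hid g)) (hid (B.vcomp f g))
  -- horizontal composites of 2-cells
  | cell_hcomp {a b c : B.Obj} {α β : a ⟶ b} {α' β' : b ⟶ c} (η : α ⟶ β) (θ : α' ⟶ β') :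
      Rel (hcomp (cell η) (cell θ) rfl) (cell (η ▷ α' ≫ β ◁ θ))
  -- naturality of the identity transformations and of the associator
  | leftUnitor {a b c d : B.Obj} {α : a ⟶ b} {β : c ⟶ d} (φ : FormalSquare B α β) :
      Rel (vcomp (hcomp (hid φ.src) φ rfl) (cell (λ_ β).hom)) (vcomp (cell (λ_ α).hom) φ)
  | rightUnitor {a b c d : B.Obj} {α : a ⟶ b} {β : c ⟶ d} (φ : FormalSquare B α β) :
      Rel (vcomp (hcomp φ (hid φ.tgt) rfl) (cell (ρ_ β).hom)) (vcomp (cell (ρ_ α).hom) φ)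
  | associator {a b c d a' b' c' d' : B.Obj} {α : a ⟶ b} {β : b ⟶ c} {γ : c ⟶ d}
      {α' : a' ⟶ b'} {β' : b' ⟶ c'} {γ' : c' ⟶ d'} (φ : FormalSquare B α α')
      (ψ : FormalSquare B β β') (χ : FormalSquare B γ γ') (h : φ.tgt = ψ.src) (h' : ψ.tgt = χ.src) :
      Rel (vcomp (hcomp (hcomp φ ψ h) χ h') (cell (α_ α' β' γ').hom))
        (vcomp (cell (α_ α β γ).hom) (hcomp φ (hcomp ψ χ h') h))

theorem Rel.src_tgt_eq {a b c d : B.Obj} {α : a ⟶ b} {β : c ⟶ d} {φ ψ : FormalSquare B α β}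
    (h : Rel φ ψ) : φ.src = ψ.src ∧ φ.tgt = ψ.tgt := by
  induction h with
  | refl => exact ⟨rfl, rfl⟩
  | symm _ ih => exact ⟨ih.1.symm, ih.2.symm⟩
  | trans _ _ ih ih' => exact ⟨ih.1.trans ih'.1, ih.2.trans ih'.2⟩
  | vcomp_congr _ _ ih ih' =>
    exact ⟨congrArg₂ B.vcomp ih.1 ih'.1, congrArg₂ B.vcomp ih.2 ih'.2⟩
  | hcomp_congr _ _ _ _ ih ih' => exact ⟨ih.1, ih'.2⟩
  | vid_vcomp φ => exact ⟨@Category.id_comp B.Obj B.decoration _ _ φ.src, @Category.id_comp B.Obj B.decoration _ _ φ.tgt⟩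
  | vcomp_vid φ => exact ⟨@Category.comp_id B.Obj B.decoration _ _ φ.src, @Category.comp_id B.Obj B.decoration _ _ φ.tgt⟩
  | vcomp_assoc φ ψ χ =>
    exact ⟨@Category.assoc B.Obj B.decoration _ _ _ _ φ.src ψ.src χ.src,
      @Category.assoc B.Obj B.decoration _ _ _ _ φ.tgt ψ.tgt χ.tgt⟩
  | exchange => exact ⟨rfl, rfl⟩
  | cell_id => exact ⟨rfl, rfl⟩
  | cell_comp => exact ⟨@Category.id_comp B.Obj B.decoration _ _ _, @Category.id_comp B.Obj B.decoration _ _ _⟩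
  | hid_id => exact ⟨rfl, rfl⟩
  | hid_comp => exact ⟨rfl, rfl⟩
  | cell_hcomp => exact ⟨rfl, rfl⟩
  | leftUnitor φ =>
    exact ⟨(@Category.comp_id B.Obj B.decoration _ _ φ.src).trans (@Category.id_comp B.Obj B.decoration _ _ φ.src).symm,
      (@Category.comp_id B.Obj B.decoration _ _ φ.tgt).trans (@Category.id_comp B.Obj B.decoration _ _ φ.tgt).symm⟩
  | rightUnitor φ =>
    exact ⟨(@Category.comp_id B.Obj B.decoration _ _ φ.src).trans (@Category.id_comp B.Obj B.decoration _ _ φ.src).symm,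
      (@Category.comp_id B.Obj B.decoration _ _ φ.tgt).trans (@Category.id_comp B.Obj B.decoration _ _ φ.tgt).symm⟩
  | associator φ ψ χ =>
    exact ⟨(@Category.comp_id B.Obj B.decoration _ _ φ.src).trans (@Category.id_comp B.Obj B.decoration _ _ φ.src).symm,
      (@Category.comp_id B.Obj B.decoration _ _ χ.tgt).trans (@Category.id_comp B.Obj B.decoration _ _ χ.tgt).symm⟩

/-- The equivalence relation `Rel`. -/
instance setoid {a b c d : B.Obj} (α : a ⟶ b) (β : c ⟶ d) : Setoid (FormalSquare B α β) :=
  ⟨Rel, Rel.refl, Rel.symm, Rel.trans⟩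

end FormalSquare

/-- Squares of the free globularly generated double category. -/
def FreeSquare (B : DecoratedBicategory.{w, v, x, u}) {a b c d : B.Obj} (α : a ⟶ b) (β : c ⟶ d) :
    Type (max u v w x) :=
  Quotient (FormalSquare.setoid α β)

namespace FreeSquare

variable {B : DecoratedBicategory.{w, v, x, u}}

/-- The class of a formal square. -/
def mk {a b c d : B.Obj} {α : a ⟶ b} {β : c ⟶ d} (φ : FormalSquare B α β) : FreeSquare B α β :=
  Quotient.mk _ φ

/-- The class of a 2-cell. -/
def cell {a b : B.Obj} {α β : a ⟶ b} (η : α ⟶ β) : FreeSquare B α β := mk (.cell η)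

/-- The class of a formal horizontal identity. -/
def hid {a c : B.Obj} (f : B.VHom a c) : FreeSquare B (𝟙 a) (𝟙 c) := mk (.hid f)

/-- Vertical identity. -/
def vid {a b : B.Obj} (α : a ⟶ b) : FreeSquare B α α := mk (.vid α)

theorem sound {a b c d : B.Obj} {α : a ⟶ b} {β : c ⟶ d} {φ ψ : FormalSquare B α β}
    (h : FormalSquare.Rel φ ψ) : mk φ = mk ψ := Quotient.sound h

/-- Left edge. -/
def src {a b c d : B.Obj} {α : a ⟶ b} {β : c ⟶ d} (φ : FreeSquare B α β) : B.VHom a c :=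
  Quotient.lift FormalSquare.src (fun _ _ h => (FormalSquare.Rel.src_tgt_eq h).1) φ

/-- Right edge. -/
def tgt {a b c d : B.Obj} {α : a ⟶ b} {β : c ⟶ d} (φ : FreeSquare B α β) : B.VHom b d :=
  Quotient.lift FormalSquare.tgt (fun _ _ h => (FormalSquare.Rel.src_tgt_eq h).2) φ

/-- Vertical composition. -/
def vcomp {a b c d e k : B.Obj} {α : a ⟶ b} {β : c ⟶ d} {γ : e ⟶ k}
    (φ : FreeSquare B α β) (ψ : FreeSquare B β γ) : FreeSquare B α γ :=
  Quotient.map₂ FormalSquare.vcomp (fun _ _ h _ _ h' => FormalSquare.Rel.vcomp_congr h h') φ ψ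

/-- Horizontal composition, as a partial operation. -/
def hcompPart {a a' a'' c c' c'' : B.Obj} {α : a ⟶ a'} {α' : a' ⟶ a''} {β : c ⟶ c'} {β' : c' ⟶ c''}
    (φ : FreeSquare B α β) (ψ : FreeSquare B α' β') : Part (FreeSquare B (α ≫ α') (β ≫ β')) :=
  Quotient.lift₂ (fun φ ψ => ⟨φ.tgt = ψ.src, fun h => mk (FormalSquare.hcomp φ ψ h)⟩)
    (fun _ _ _ _ h h' => Part.ext'
      (by simp only [(FormalSquare.Rel.src_tgt_eq h).2, (FormalSquare.Rel.src_tgt_eq h').1])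
      (fun e e' => sound (FormalSquare.Rel.hcomp_congr e e' h h'))) φ ψ

theorem hcompPart_dom {a a' a'' c c' c'' : B.Obj} {α : a ⟶ a'} {α' : a' ⟶ a''} {β : c ⟶ c'}
    {β' : c' ⟶ c''} (φ : FreeSquare B α β) (ψ : FreeSquare B α' β') (h : φ.tgt = ψ.src) :
    (hcompPart φ ψ).Dom := by
  induction φ using Quotient.ind
  induction ψ using Quotient.ind
  exact h

/-- Horizontal composition of compatible squares. -/
def hcomp {a a' a'' c c' c'' : B.Obj} {α : a ⟶ a'} {α' : a' ⟶ a''} {β : c ⟶ c'} {β' : c' ⟶ c''}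
    (φ : FreeSquare B α β) (ψ : FreeSquare B α' β') (h : φ.tgt = ψ.src) :
    FreeSquare B (α ≫ α') (β ≫ β') :=
  (hcompPart φ ψ).get (hcompPart_dom φ ψ h)

theorem hcomp_mk {a a' a'' c c' c'' : B.Obj} {α : a ⟶ a'} {α' : a' ⟶ a''} {β : c ⟶ c'}
    {β' : c' ⟶ c''} (φ : FormalSquare B α β) (ψ : FormalSquare B α' β') (h : φ.tgt = ψ.src) :
    hcomp (mk φ) (mk ψ) h = mk (FormalSquare.hcomp φ ψ h) := rfl

theorem cell_vcomp_cell {a b : B.Obj} {α β γ : a ⟶ b} (η : α ⟶ β) (θ : β ⟶ γ) :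
    vcomp (cell η) (cell θ) = cell (η ≫ θ) := sound (.cell_comp η θ)

theorem cell_id {a b : B.Obj} (α : a ⟶ b) : cell (𝟙 α) = vid α := sound (.cell_id α)

theorem cell_hcomp_cell {a b c : B.Obj} {α β : a ⟶ b} {α' β' : b ⟶ c} (η : α ⟶ β) (θ : α' ⟶ β') :
    hcomp (cell η) (cell θ) rfl = cell (η ▷ α' ≫ β ◁ θ) := sound (.cell_hcomp η θ)

end FreeSquare

namespace DecoratedBicategory

variable (B : DecoratedBicategory.{w, v, x, u})

/-- The categories and functors underlying the free globularly generated double category. -/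
abbrev freeData : DoubleCategoryData.{v, x, u, max u v w x} where
  Obj := B.Obj
  vert := B.decoration
  Hor a b := a ⟶ b
  Sq α β := FreeSquare B α β
  vidSq α := FreeSquare.vid α
  vcompSq φ ψ := FreeSquare.vcomp φ ψ
  vidSq_vcompSq := by rintro _ _ _ _ _ _ ⟨φ⟩; exact FreeSquare.sound (.vid_vcomp φ)
  vcompSq_vidSq := by rintro _ _ _ _ _ _ ⟨φ⟩; exact FreeSquare.sound (.vcomp_vid φ)
  vcompSq_assoc := by
    rintro _ _ _ _ _ _ _ _ _ _ _ _ ⟨φ⟩ ⟨ψ⟩ ⟨χ⟩; exact FreeSquare.sound (.vcomp_assoc φ ψ χ)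
  src φ := φ.src
  tgt φ := φ.tgt
  src_vidSq _ := rfl
  tgt_vidSq _ := rfl
  src_vcompSq := by rintro _ _ _ _ _ _ _ _ _ ⟨φ⟩ ⟨ψ⟩; rfl
  tgt_vcompSq := by rintro _ _ _ _ _ _ _ _ _ ⟨φ⟩ ⟨ψ⟩; rfl
  hid a := 𝟙 a
  hidSq f := FreeSquare.hid f
  src_hidSq _ := rfl
  tgt_hidSq _ := rfl
  hidSq_id a := FreeSquare.sound (.hid_id a)
  hidSq_comp f g := (FreeSquare.sound (.hid_comp f g)).symm
  hcomp α β := α ≫ β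
  hcompSq φ ψ h := FreeSquare.hcomp φ ψ h
  src_hcompSq := by rintro _ _ _ _ _ _ _ _ _ _ ⟨φ⟩ ⟨ψ⟩ h; rfl
  tgt_hcompSq := by rintro _ _ _ _ _ _ _ _ _ _ ⟨φ⟩ ⟨ψ⟩ h; rfl
  hcompSq_vidSq α β := by
    have h := FreeSquare.cell_hcomp_cell (𝟙 α) (𝟙 β)
    simp only [id_whiskerRight, whiskerLeft_id, Category.comp_id, FreeSquare.cell_id] at h
    exact h
  hcompSq_vcompSq := by
    rintro _ _ _ _ _ _ _ _ _ _ _ _ _ _ _ ⟨φ₁⟩ ⟨φ₂⟩ ⟨ψ₁⟩ ⟨ψ₂⟩ h₁ h₂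
    exact FreeSquare.sound (.exchange φ₁ φ₂ ψ₁ ψ₂ h₁ h₂ _)

variable {B} in
/-- The globular square of a 2-cell. -/
def freeGlob {a b : B.Obj} {α β : a ⟶ b} (η : α ⟶ β) :
    @Quiver.Hom (B.freeData.Hor a b) (B.freeData.globCategory a b).toQuiver α β :=
  ⟨FreeSquare.cell η, rfl, rfl⟩

variable {B} in
/-- The globular isomorphism of an invertible 2-cell. -/
def freeGlobIso {a b : B.Obj} {α β : a ⟶ b} (η : α ≅ β) :
    @Iso (B.freeData.Hor a b) (B.freeData.globCategory a b) α β :=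
  letI := B.freeData.globCategory a b
  { hom := freeGlob η.hom
    inv := freeGlob η.inv
    hom_inv_id := glob_ext ((FreeSquare.cell_vcomp_cell η.hom η.inv).trans
      ((congrArg FreeSquare.cell η.hom_inv_id).trans (FreeSquare.cell_id α)))
    inv_hom_id := glob_ext ((FreeSquare.cell_vcomp_cell η.inv η.hom).trans
      ((congrArg FreeSquare.cell η.inv_hom_id).trans (FreeSquare.cell_id β))) }

section glob

variable {B}

theorem freeGlob_id {a b : B.Obj} (α : a ⟶ b) : freeGlob (𝟙 α) = B.freeData.globId α :=
  Glob.ext (FreeSquare.cell_id α)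

theorem freeGlob_comp {a b : B.Obj} {α β γ : a ⟶ b} (η : α ⟶ β) (θ : β ⟶ γ) :
    freeGlob (η ≫ θ) = B.freeData.globVcomp (freeGlob η) (freeGlob θ) :=
  Glob.ext (FreeSquare.cell_vcomp_cell η θ).symm

theorem globComp_freeGlob {a b c : B.Obj} {α β : a ⟶ b} {α' β' : b ⟶ c} (η : α ⟶ β)
    (θ : α' ⟶ β') :
    globComp (C := B.freeData) (freeGlob η) (freeGlob θ) = freeGlob (η ▷ α' ≫ β ◁ θ) :=
  Glob.ext (FreeSquare.cell_hcomp_cell η θ)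

theorem freeGlob_whiskerLeft {a b c : B.Obj} (α : a ⟶ b) {β γ : b ⟶ c} (η : β ⟶ γ) :
    freeGlob (α ◁ η) = globComp (C := B.freeData) (B.freeData.globId α) (freeGlob η) := by
  rw [← freeGlob_id, globComp_freeGlob, id_whiskerRight, Category.id_comp]

theorem freeGlob_whiskerRight {a b c : B.Obj} {α β : a ⟶ b} (η : α ⟶ β) (γ : b ⟶ c) :
    freeGlob (η ▷ γ) = globComp (C := B.freeData) (freeGlob η) (B.freeData.globId γ) := by
  rw [← freeGlob_id, globComp_freeGlob, whiskerLeft_id, Category.comp_id]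

theorem freeGlob_whiskerLeft_inclusion {a b c : B.Obj} (α : a ⟶ b) {β γ : b ⟶ c} (η : β ⟶ γ) :
    freeGlob (α ◁ η) = B.freeData.globVcomp (B.freeData.globId (α ≫ β))
      (B.freeData.globVcomp (globComp (C := B.freeData) (B.freeData.globId α) (freeGlob η))
        (B.freeData.globId (α ≫ γ))) := by
  rw [id_globVcomp, freeGlob_whiskerLeft]; exact (globVcomp_id _).symm

theorem freeGlob_whiskerRight_inclusion {a b c : B.Obj} {α β : a ⟶ b} (η : α ⟶ β) (γ : b ⟶ c) :
    freeGlob (η ▷ γ) = B.freeData.globVcomp (B.freeData.globId (α ≫ γ))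
      (B.freeData.globVcomp (globComp (C := B.freeData) (freeGlob η) (B.freeData.globId γ))
        (B.freeData.globId (β ≫ γ))) := by
  rw [id_globVcomp, freeGlob_whiskerRight]; exact (globVcomp_id _).symm

theorem freeGlob_associator_inclusion {a b c d : B.Obj} (α : a ⟶ b) (β : b ⟶ c) (γ : c ⟶ d) :
    freeGlob (α_ α β γ).hom = B.freeData.globVcomp (B.freeData.globId ((α ≫ β) ≫ γ))
      (B.freeData.globVcomp
        (globComp (C := B.freeData) (B.freeData.globId (α ≫ β)) (B.freeData.globId γ))
        (B.freeData.globVcomp (freeGlob (α_ α β γ).hom)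
          (B.freeData.globVcomp
            (globComp (C := B.freeData) (B.freeData.globId α) (B.freeData.globId (β ≫ γ)))
            (B.freeData.globId (α ≫ β ≫ γ))))) := by
  rw [globComp_globId, globComp_globId, id_globVcomp, id_globVcomp, id_globVcomp, globVcomp_id]

theorem freeGlob_leftUnitor_inclusion {a b : B.Obj} (α : a ⟶ b) :
    freeGlob (λ_ α).hom = B.freeData.globVcomp (B.freeData.globId (𝟙 a ≫ α))
      (B.freeData.globVcomp
        (globComp (C := B.freeData) (B.freeData.globId (𝟙 a)) (B.freeData.globId α))
        (freeGlob (λ_ α).hom)) := by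
  rw [globComp_globId, id_globVcomp, id_globVcomp]

theorem freeGlob_rightUnitor_inclusion {a b : B.Obj} (α : a ⟶ b) :
    freeGlob (ρ_ α).hom = B.freeData.globVcomp (B.freeData.globId (α ≫ 𝟙 b))
      (B.freeData.globVcomp
        (globComp (C := B.freeData) (B.freeData.globId α) (B.freeData.globId (𝟙 b)))
        (freeGlob (ρ_ α).hom)) := by
  rw [globComp_globId, id_globVcomp, id_globVcomp]

theorem freeGlob_pentagon {a b c d e : B.Obj} (α : a ⟶ b) (β : b ⟶ c) (γ : c ⟶ d) (δ : d ⟶ e) :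
    B.freeData.globVcomp
      (globComp (C := B.freeData) (freeGlob (α_ α β γ).hom) (B.freeData.globId δ))
      (B.freeData.globVcomp (freeGlob (α_ α (β ≫ γ) δ).hom)
        (globComp (C := B.freeData) (B.freeData.globId α) (freeGlob (α_ β γ δ).hom))) =
    B.freeData.globVcomp (freeGlob (α_ (α ≫ β) γ δ).hom) (freeGlob (α_ α β (γ ≫ δ)).hom) := by
  rw [← freeGlob_whiskerLeft, ← freeGlob_whiskerRight, ← freeGlob_comp, ← freeGlob_comp,
    ← freeGlob_comp, Bicategory.pentagon]

theorem freeGlob_triangle {a b c : B.Obj} (α : a ⟶ b) (β : b ⟶ c) :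
    B.freeData.globVcomp (freeGlob (α_ α (𝟙 b) β).hom)
      (globComp (C := B.freeData) (B.freeData.globId α) (freeGlob (λ_ β).hom)) =
    globComp (C := B.freeData) (freeGlob (ρ_ α).hom) (B.freeData.globId β) := by
  rw [← freeGlob_whiskerLeft, ← freeGlob_whiskerRight, ← freeGlob_comp, Bicategory.triangle]

end glob

/-- The free globularly generated double category of a decorated bicategory. -/
def free : DoubleCategory.{v, x, u, max u v w x} where
  data := B.freeData
  associator α β γ := freeGlobIso (α_ α β γ)
  leftUnitor α := freeGlobIso (λ_ α)
  rightUnitor α := freeGlobIso (ρ_ α)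
  associator_naturality := by
    rintro _ _ _ _ _ _ _ _ _ _ _ _ _ _ ⟨φ⟩ ⟨ψ⟩ ⟨χ⟩ h h'
    exact FreeSquare.sound (.associator φ ψ χ h h')
  leftUnitor_naturality := by
    rintro _ _ _ _ _ _ ⟨φ⟩; exact FreeSquare.sound (.leftUnitor φ)
  rightUnitor_naturality := by
    rintro _ _ _ _ _ _ ⟨φ⟩; exact FreeSquare.sound (.rightUnitor φ)
  pentagon α β γ δ := freeGlob_pentagon α β γ δ
  triangle α β := freeGlob_triangle α β

/-- The inclusion of a decorated bicategory in the decorated horizontalization of its free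
globularly generated double category: the identity on objects, vertical morphisms and 1-cells, a
2-cell being sent to the corresponding globular square, with identity coherence 2-cells. -/
def inclusion : DecoratedPseudofunctor B B.free.horizontalization where
  toPseudo := letI := B.free.horizontalBicategory
    { obj := fun a => a
      map := fun α => α
      map₂ := fun η => freeGlob η
      map₂_id := fun α => freeGlob_id α
      map₂_comp := fun η θ => freeGlob_comp η θ
      mapId := fun a => @Iso.refl (B.freeData.Hor a a) (B.freeData.globCategory a a) (𝟙 a)
      mapComp := fun {a _ c} α β =>
        @Iso.refl (B.freeData.Hor a c) (B.freeData.globCategory a c) (α ≫ β)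
      map₂_whisker_left := fun α _ _ η => freeGlob_whiskerLeft_inclusion α η
      map₂_whisker_right := fun η α => freeGlob_whiskerRight_inclusion η α
      map₂_associator := fun α β γ => freeGlob_associator_inclusion α β γ
      map₂_left_unitor := fun α => freeGlob_leftUnitor_inclusion α
      map₂_right_unitor := fun α => freeGlob_rightUnitor_inclusion α }
  vmap f := f
  vmap_id _ := rfl
  vmap_comp _ _ := rfl

end DecoratedBicategory

/-! ## The action of a decorated pseudofunctor on formal squares -/

namespace DecoratedPseudofunctor

variable {B : DecoratedBicategory.{w, v, x, u}} {B' : DecoratedBicategory.{w', v', x', u'}}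
  (G : DecoratedPseudofunctor B B')

/-- The action on formal expressions, by recursion: apply `G` to the generators and preserve the
formal operations, inserting the coherence 2-cells of `G` at horizontal identities and horizontal
composites in order to correct the top and bottom edges. -/
def mapPre : ∀ {a b c d : B.Obj} {α : a ⟶ b} {β : c ⟶ d}, PreSquare B α β →
    PreSquare B' (G.toPseudo.map α) (G.toPseudo.map β)
  | _, _, _, _, _, _, .cell η => .cell (G.toPseudo.map₂ η)
  | _, _, _, _, _, _, .hid (a := a) (c := c) f =>
    .vcomp (.cell (G.toPseudo.mapId a).hom)
      (.vcomp (.hid (G.vmap f)) (.cell (G.toPseudo.mapId c).inv))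
  | _, _, _, _, _, _, .vid α => .vid (G.toPseudo.map α)
  | _, _, _, _, _, _, .vcomp φ ψ => .vcomp (mapPre φ) (mapPre ψ)
  | _, _, _, _, _, _, .hcomp (α := α) (α' := α') (β := β) (β' := β') φ ψ =>
    .vcomp (.cell (G.toPseudo.mapComp α α').hom)
      (.vcomp (.hcomp (mapPre φ) (mapPre ψ)) (.cell (G.toPseudo.mapComp β β').inv))

theorem mapPre_src_tgt {a b c d : B.Obj} {α : a ⟶ b} {β : c ⟶ d} (φ : PreSquare B α β) :
    (G.mapPre φ).src = G.vmap φ.src ∧ (G.mapPre φ).tgt = G.vmap φ.tgt := by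
  have e : ∀ {p q : B'.Obj} (f : B'.VHom p q),
      B'.vcomp (B'.vid p) (B'.vcomp f (B'.vid q)) = f := fun {p q} f =>
    (@Category.id_comp B'.Obj B'.decoration _ _ _).trans
      (@Category.comp_id B'.Obj B'.decoration _ _ f)
  induction φ with
  | cell η => exact ⟨(G.vmap_id _).symm, (G.vmap_id _).symm⟩
  | hid f => exact ⟨e _, e _⟩
  | vid α => exact ⟨(G.vmap_id _).symm, (G.vmap_id _).symm⟩
  | vcomp φ ψ ih ih' =>
    exact ⟨(congrArg₂ B'.vcomp ih.1 ih'.1).trans (G.vmap_comp _ _).symm,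
      (congrArg₂ B'.vcomp ih.2 ih'.2).trans (G.vmap_comp _ _).symm⟩
  | hcomp φ ψ ih ih' => exact ⟨(e _).trans ih.1, (e _).trans ih'.2⟩

theorem mapPre_wf {a b c d : B.Obj} {α : a ⟶ b} {β : c ⟶ d} (φ : PreSquare B α β) (h : φ.WF) :
    (G.mapPre φ).WF := by
  induction φ with
  | cell η => trivial
  | hid f => exact ⟨trivial, trivial, trivial⟩
  | vid α => trivial
  | vcomp φ ψ ih ih' => exact ⟨ih h.1, ih' h.2⟩
  | hcomp φ ψ ih ih' =>
    refine ⟨trivial, ⟨ih h.1, ih' h.2.1, ?_⟩, trivial⟩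
    rw [(G.mapPre_src_tgt φ).2, (G.mapPre_src_tgt ψ).1, h.2.2]

/-- The action on formal squares. -/
def mapFormal {a b c d : B.Obj} {α : a ⟶ b} {β : c ⟶ d} (φ : FormalSquare B α β) :
    FormalSquare B' (G.toPseudo.map α) (G.toPseudo.map β) :=
  ⟨G.mapPre φ.1, G.mapPre_wf φ.1 φ.2⟩

end DecoratedPseudofunctor

/-! ## The set of all squares and the free vertical filtration -/

/-- A square of a double category together with its top and bottom edges. -/
structure DoubleCategoryData.Square (C : DoubleCategoryData.{v, x, u, s}) where
  {topLeft : C.Obj}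
  {topRight : C.Obj}
  {bottomLeft : C.Obj}
  {bottomRight : C.Obj}
  {top : C.Hor topLeft topRight}
  {bottom : C.Hor bottomLeft bottomRight}
  sq : C.Sq top bottom

/-- The action of a double functor on the set of all squares. -/
def DoubleFunctor.mapSquare {C : DoubleCategory.{v, x, u, s}} {D : DoubleCategory.{v', x', u', s'}}
    (F : DoubleFunctor C D) (σ : C.data.Square) : D.data.Square :=
  ⟨F.sqmap σ.sq⟩

namespace DecoratedBicategory

variable (B : DecoratedBicategory.{w, v, x, u})

variable {B} in
/-- The square of the free globularly generated double category represented by a formal square. -/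
def freeSquare {a b c d : B.Obj} {α : a ⟶ b} {β : c ⟶ d} (φ : FormalSquare B α β) :
    B.free.data.Square :=
  ⟨(FreeSquare.mk φ : FreeSquare B α β)⟩

/-- The free vertical filtration, indexed from `0`: the squares represented by a formal square in
the corresponding stage of the filtration `F`. -/
def freeVertical (k : ℕ) : Set B.free.data.Square :=
  {σ | ∃ (a b c d : B.Obj) (α : a ⟶ b) (β : c ⟶ d) (φ : FormalSquare B α β),
    FormalSquare.InF k φ ∧ σ = freeSquare φ}

end DecoratedBicategory

end DoubleCats

/-!
The map `Φ ↦ GΦ` on formal squares respects the congruence that defines the free double category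
(`DecoratedPseudofunctor.mapClass_eq_of_rel`). It inserts a coherence isomorphism of `G` above each
formal horizontal identity or composite and its inverse below, so in a vertical composite the inner
isomorphisms cancel; this gives functoriality of horizontal identities and the exchange law. For the
unitors and the associator, the exchange law moves the coherence isomorphisms of the factors of a
horizontal composite to the outside (`FreeSquare.hcomp_cell_vcomp_vcomp_cell`), where the coherence
laws of `G` turn the images of the structure 2-cells of `B` into those of `B'`. The induced map on
classes is the double functor `DecoratedPseudofunctor.mapFree`: naturality of its comparison
isomorphisms is the definition of `GΦ`, and its coherence laws are those of `G`.

Uniqueness (`DoubleFunctor.eq_of_inclusion_comp_eq`) is an induction on formal squares. The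
restriction of a double functor to `B` prescribes its values on 2-cells and its comparison
isomorphisms, and naturality of the latter leaves one choice for the value on a horizontal identity
or on a horizontal composite.

For the filtration, the image of a horizontal word need not be a horizontal word, because coherence
isomorphisms occur inside it. By the exchange law they can be collected into one 2-cell above and
one below a horizontal word (`DecoratedPseudofunctor.isConjugate_mapClass_of_hWord`). Since 2-cells
belong to every stage of the filtration, the whole is a vertical composite of squares of the same
stage (`DecoratedPseudofunctor.isConjugate_mapClass_of_inE`).
-/

namespace DoubleCats

/-! ### Calculus of squares of the free double category -/

namespace FreeSquare

variable {B : DecoratedBicategory.{w, v, x, u}}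

theorem vcomp_assoc {a b c d e k l m : B.Obj} {α : a ⟶ b} {β : c ⟶ d} {γ : e ⟶ k}
    {δ : l ⟶ m} (φ : FreeSquare B α β) (ψ : FreeSquare B β γ) (χ : FreeSquare B γ δ) :
    vcomp (vcomp φ ψ) χ = vcomp φ (vcomp ψ χ) :=
  B.freeData.vcompSq_assoc φ ψ χ

theorem vid_vcomp {a b c d : B.Obj} {α : a ⟶ b} {β : c ⟶ d} (φ : FreeSquare B α β) :
    vcomp (vid α) φ = φ :=
  B.freeData.vidSq_vcompSq φ

theorem vcomp_vid {a b c d : B.Obj} {α : a ⟶ b} {β : c ⟶ d} (φ : FreeSquare B α β) :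
    vcomp φ (vid β) = φ :=
  B.freeData.vcompSq_vidSq φ

theorem cell_vcomp_cell_vcomp {a b c d : B.Obj} {α β γ : a ⟶ b} {δ : c ⟶ d} (η : α ⟶ β)
    (θ : β ⟶ γ) (φ : FreeSquare B γ δ) :
    vcomp (cell η) (vcomp (cell θ) φ) = vcomp (cell (η ≫ θ)) φ := by
  rw [← vcomp_assoc, cell_vcomp_cell]

theorem cell_id_vcomp {a b c d : B.Obj} {α : a ⟶ b} {β : c ⟶ d} (φ : FreeSquare B α β) :
    vcomp (cell (𝟙 α)) φ = φ := by
  rw [cell_id, vid_vcomp]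

theorem vcomp_cell_id {a b c d : B.Obj} {α : a ⟶ b} {β : c ⟶ d} (φ : FreeSquare B α β) :
    vcomp φ (cell (𝟙 β)) = φ := by
  rw [cell_id, vcomp_vid]

theorem cell_inv_vcomp_cell_hom_vcomp {a b c d : B.Obj} {α β : a ⟶ b} {γ : c ⟶ d} (η : α ≅ β)
    (φ : FreeSquare B β γ) : vcomp (cell η.inv) (vcomp (cell η.hom) φ) = φ := by
  rw [cell_vcomp_cell_vcomp, η.inv_hom_id, cell_id_vcomp]

theorem src_vcomp {a b c d e k : B.Obj} {α : a ⟶ b} {β : c ⟶ d} {γ : e ⟶ k}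
    (φ : FreeSquare B α β) (ψ : FreeSquare B β γ) :
    (vcomp φ ψ).src = B.vcomp φ.src ψ.src :=
  B.freeData.src_vcompSq φ ψ

theorem tgt_vcomp {a b c d e k : B.Obj} {α : a ⟶ b} {β : c ⟶ d} {γ : e ⟶ k}
    (φ : FreeSquare B α β) (ψ : FreeSquare B β γ) :
    (vcomp φ ψ).tgt = B.vcomp φ.tgt ψ.tgt :=
  B.freeData.tgt_vcompSq φ ψ

/-- Pasting globular squares of 2-cells above and below a square does not change its left edge. -/
theorem src_cell_vcomp_vcomp_cell {a b c d : B.Obj} {α α' : a ⟶ b} {β β' : c ⟶ d} (η : α ⟶ α')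
    (φ : FreeSquare B α' β') (θ : β' ⟶ β) :
    (vcomp (cell η) (vcomp φ (cell θ))).src = φ.src := by
  rw [src_vcomp, src_vcomp]
  exact (@Category.id_comp B.Obj B.decoration _ _ _).trans
    (@Category.comp_id B.Obj B.decoration _ _ _)

/-- Pasting globular squares of 2-cells above and below a square does not change its right edge. -/
theorem tgt_cell_vcomp_vcomp_cell {a b c d : B.Obj} {α α' : a ⟶ b} {β β' : c ⟶ d} (η : α ⟶ α')
    (φ : FreeSquare B α' β') (θ : β' ⟶ β) :
    (vcomp (cell η) (vcomp φ (cell θ))).tgt = φ.tgt := by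
  rw [tgt_vcomp, tgt_vcomp]
  exact (@Category.id_comp B.Obj B.decoration _ _ _).trans
    (@Category.comp_id B.Obj B.decoration _ _ _)

theorem hcomp_congr {a a' a'' c c' c'' : B.Obj} {α : a ⟶ a'} {α' : a' ⟶ a''} {β : c ⟶ c'}
    {β' : c' ⟶ c''} {φ φ' : FreeSquare B α β} {ψ ψ' : FreeSquare B α' β'}
    (hφ : φ = φ') (hψ : ψ = ψ') (h : φ.tgt = ψ.src) (h' : φ'.tgt = ψ'.src) :
    hcomp φ ψ h = hcomp φ' ψ' h' := by
  subst hφ hψ; rfl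

theorem src_hcomp {a a' a'' c c' c'' : B.Obj} {α : a ⟶ a'} {α' : a' ⟶ a''} {β : c ⟶ c'}
    {β' : c' ⟶ c''} (φ : FreeSquare B α β) (ψ : FreeSquare B α' β') (h : φ.tgt = ψ.src) :
    (hcomp φ ψ h).src = φ.src :=
  B.freeData.src_hcompSq φ ψ h

theorem tgt_hcomp {a a' a'' c c' c'' : B.Obj} {α : a ⟶ a'} {α' : a' ⟶ a''} {β : c ⟶ c'}
    {β' : c' ⟶ c''} (φ : FreeSquare B α β) (ψ : FreeSquare B α' β') (h : φ.tgt = ψ.src) :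
    (hcomp φ ψ h).tgt = ψ.tgt :=
  B.freeData.tgt_hcompSq φ ψ h

theorem hcomp_vcomp_vcomp {a a' a'' c c' c'' e e' e'' : B.Obj} {α : a ⟶ a'} {α' : a' ⟶ a''}
    {β : c ⟶ c'} {β' : c' ⟶ c''} {γ : e ⟶ e'} {γ' : e' ⟶ e''}
    (φ₁ : FreeSquare B α β) (φ₂ : FreeSquare B β γ) (ψ₁ : FreeSquare B α' β')
    (ψ₂ : FreeSquare B β' γ') (h₁ : φ₁.tgt = ψ₁.src) (h₂ : φ₂.tgt = ψ₂.src)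
    (h : (vcomp φ₁ φ₂).tgt = (vcomp ψ₁ ψ₂).src) :
    hcomp (vcomp φ₁ φ₂) (vcomp ψ₁ ψ₂) h = vcomp (hcomp φ₁ ψ₁ h₁) (hcomp φ₂ ψ₂ h₂) :=
  B.freeData.hcompSq_vcompSq φ₁ φ₂ ψ₁ ψ₂ h₁ h₂

/-- The exchange law for horizontal composites of squares conjugated by 2-cells: the 2-cells can be
collected above and below the horizontal composite. -/
theorem hcomp_cell_vcomp_vcomp_cell {a a' a'' c c' c'' : B.Obj} {α γ : a ⟶ a'} {α' γ' : a' ⟶ a''}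
    {β δ : c ⟶ c'} {β' δ' : c' ⟶ c''} (η : α ⟶ γ) (φ : FreeSquare B γ δ) (θ : δ ⟶ β)
    (η' : α' ⟶ γ') (ψ : FreeSquare B γ' δ') (θ' : δ' ⟶ β') (h : φ.tgt = ψ.src)
    (h' : (vcomp (cell η) (vcomp φ (cell θ))).tgt = (vcomp (cell η') (vcomp ψ (cell θ'))).src) :
    hcomp (vcomp (cell η) (vcomp φ (cell θ))) (vcomp (cell η') (vcomp ψ (cell θ'))) h' =
      vcomp (cell (η ▷ α' ≫ γ ◁ η')) (vcomp (hcomp φ ψ h) (cell (θ ▷ δ' ≫ β ◁ θ'))) := by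
  have h'' : (vcomp φ (cell θ)).tgt = (vcomp ψ (cell θ')).src := by
    rw [tgt_vcomp, src_vcomp, h]; rfl
  rw [hcomp_vcomp_vcomp _ _ _ _ rfl h'', hcomp_vcomp_vcomp _ _ _ _ h rfl, cell_hcomp_cell,
    cell_hcomp_cell]

/-- Conjugation by 2-cells of the left factor of a horizontal composite. -/
theorem hcomp_cell_vcomp_vcomp_cell_left {a a' a'' c c' c'' : B.Obj} {α γ : a ⟶ a'}
    {α' : a' ⟶ a''} {β δ : c ⟶ c'} {β' : c' ⟶ c''} (η : α ⟶ γ) (φ : FreeSquare B γ δ) (θ : δ ⟶ β)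
    (ψ : FreeSquare B α' β') (h : φ.tgt = ψ.src)
    (h' : (vcomp (cell η) (vcomp φ (cell θ))).tgt = ψ.src) :
    hcomp (vcomp (cell η) (vcomp φ (cell θ))) ψ h' =
      vcomp (cell (η ▷ α')) (vcomp (hcomp φ ψ h) (cell (θ ▷ β'))) := by
  have e : ψ = vcomp (cell (𝟙 α')) (vcomp ψ (cell (𝟙 β'))) := by
    rw [vcomp_cell_id, cell_id_vcomp]
  rw [hcomp_congr rfl e h' (by rw [← e]; exact h'), hcomp_cell_vcomp_vcomp_cell _ _ _ _ _ _ h]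
  simp only [whiskerLeft_id, Category.comp_id]

/-- Conjugation by 2-cells of the right factor of a horizontal composite. -/
theorem hcomp_cell_vcomp_vcomp_cell_right {a a' a'' c c' c'' : B.Obj} {α : a ⟶ a'}
    {α' γ' : a' ⟶ a''} {β : c ⟶ c'} {β' δ' : c' ⟶ c''} (φ : FreeSquare B α β)
    (η' : α' ⟶ γ') (ψ : FreeSquare B γ' δ') (θ' : δ' ⟶ β') (h : φ.tgt = ψ.src)
    (h' : φ.tgt = (vcomp (cell η') (vcomp ψ (cell θ'))).src) :
    hcomp φ (vcomp (cell η') (vcomp ψ (cell θ'))) h' =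
      vcomp (cell (α ◁ η')) (vcomp (hcomp φ ψ h) (cell (β ◁ θ'))) := by
  have e : φ = vcomp (cell (𝟙 α)) (vcomp φ (cell (𝟙 β))) := by
    rw [vcomp_cell_id, cell_id_vcomp]
  rw [hcomp_congr e rfl h' (by rw [← e]; exact h'), hcomp_cell_vcomp_vcomp_cell _ _ _ _ _ _ h]
  simp only [id_whiskerRight, Category.id_comp]

theorem leftUnitor_naturality {a b c d : B.Obj} {α : a ⟶ b} {β : c ⟶ d} (φ : FreeSquare B α β)
    {f : B.VHom a c} (hf : (hid f).tgt = φ.src) :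
    vcomp (hcomp (hid f) φ hf) (cell (λ_ β).hom) = vcomp (cell (λ_ α).hom) φ := by
  obtain rfl : f = φ.src := hf
  exact B.free.leftUnitor_naturality φ

theorem rightUnitor_naturality {a b c d : B.Obj} {α : a ⟶ b} {β : c ⟶ d} (φ : FreeSquare B α β)
    {f : B.VHom b d} (hf : φ.tgt = (hid f).src) :
    vcomp (hcomp φ (hid f) hf) (cell (ρ_ β).hom) = vcomp (cell (ρ_ α).hom) φ := by
  obtain rfl : φ.tgt = f := hf
  exact B.free.rightUnitor_naturality φ

theorem associator_naturality {a b c d a' b' c' d' : B.Obj}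
    {α : a ⟶ b} {β : b ⟶ c} {γ : c ⟶ d} {α' : a' ⟶ b'} {β' : b' ⟶ c'} {γ' : c' ⟶ d'}
    (φ : FreeSquare B α α') (ψ : FreeSquare B β β') (χ : FreeSquare B γ γ')
    (h : φ.tgt = ψ.src) (h' : ψ.tgt = χ.src) (k : (hcomp φ ψ h).tgt = χ.src)
    (k' : φ.tgt = (hcomp ψ χ h').src) :
    vcomp (hcomp (hcomp φ ψ h) χ k) (cell (α_ α' β' γ').hom) =
      vcomp (cell (α_ α β γ).hom) (hcomp φ (hcomp ψ χ h') k') :=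
  B.free.associator_naturality φ ψ χ h h'

theorem hid_vid (a : B.Obj) : hid (B.vid a) = vid (𝟙 a) :=
  B.freeData.hidSq_id a

theorem hid_vcomp {a c e : B.Obj} (f : B.VHom a c) (g : B.VHom c e) :
    hid (B.vcomp f g) = vcomp (hid f) (hid g) :=
  B.freeData.hidSq_comp f g

end FreeSquare

/-! ### The action of a decorated pseudofunctor on classes of formal squares -/

namespace DecoratedPseudofunctor

open FreeSquare

variable {B : DecoratedBicategory.{w, v, x, u}} {B' : DecoratedBicategory.{w', v', x', u'}}
  (G : DecoratedPseudofunctor B B')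

/-- The class of the image of a formal square. -/
def mapClass {a b c d : B.Obj} {α : a ⟶ b} {β : c ⟶ d} (φ : FormalSquare B α β) :
    FreeSquare B' (G.toPseudo.map α) (G.toPseudo.map β) :=
  FreeSquare.mk (G.mapFormal φ)

theorem src_mapClass {a b c d : B.Obj} {α : a ⟶ b} {β : c ⟶ d} (φ : FormalSquare B α β) :
    (G.mapClass φ).src = G.vmap φ.src :=
  (G.mapPre_src_tgt φ.1).1

theorem tgt_mapClass {a b c d : B.Obj} {α : a ⟶ b} {β : c ⟶ d} (φ : FormalSquare B α β) :
    (G.mapClass φ).tgt = G.vmap φ.tgt :=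
  (G.mapPre_src_tgt φ.1).2

theorem mapClass_compatible {a a' a'' c c' c'' : B.Obj} {α : a ⟶ a'} {α' : a' ⟶ a''}
    {β : c ⟶ c'} {β' : c' ⟶ c''} {φ : FormalSquare B α β} {ψ : FormalSquare B α' β'}
    (h : φ.tgt = ψ.src) : (G.mapClass φ).tgt = (G.mapClass ψ).src := by
  rw [tgt_mapClass, src_mapClass, h]

theorem mapClass_cell {a b : B.Obj} {α β : a ⟶ b} (η : α ⟶ β) :
    G.mapClass (.cell η) = cell (G.toPseudo.map₂ η) := rfl

theorem mapClass_hid {a c : B.Obj} (f : B.VHom a c) :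
    G.mapClass (.hid f) = vcomp (cell (G.toPseudo.mapId a).hom)
      (vcomp (hid (G.vmap f)) (cell (G.toPseudo.mapId c).inv)) := rfl

theorem mapClass_vid {a b : B.Obj} (α : a ⟶ b) :
    G.mapClass (.vid α) = vid (G.toPseudo.map α) := rfl

theorem mapClass_vcomp {a b c d e k : B.Obj} {α : a ⟶ b} {β : c ⟶ d} {γ : e ⟶ k}
    (φ : FormalSquare B α β) (ψ : FormalSquare B β γ) :
    G.mapClass (.vcomp φ ψ) = vcomp (G.mapClass φ) (G.mapClass ψ) := rfl

theorem mapClass_hcomp {a a' a'' c c' c'' : B.Obj} {α : a ⟶ a'} {α' : a' ⟶ a''}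
    {β : c ⟶ c'} {β' : c' ⟶ c''} (φ : FormalSquare B α β) (ψ : FormalSquare B α' β')
    (h : φ.tgt = ψ.src) :
    G.mapClass (.hcomp φ ψ h) = vcomp (cell (G.toPseudo.mapComp α α').hom)
      (vcomp (hcomp (G.mapClass φ) (G.mapClass ψ) (G.mapClass_compatible h))
        (cell (G.toPseudo.mapComp β β').inv)) := rfl

/-- The coherence isomorphisms `G(1ₐ) ≅ 1_{Ga}` are natural with respect to horizontal identities. -/
theorem mapClass_hid_vcomp {a c : B.Obj} (f : B.VHom a c) :
    vcomp (G.mapClass (.hid f)) (cell (G.toPseudo.mapId c).hom) =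
      vcomp (cell (G.toPseudo.mapId a).hom) (hid (G.vmap f)) := by
  rw [mapClass_hid, vcomp_assoc, vcomp_assoc, cell_vcomp_cell, Iso.inv_hom_id, vcomp_cell_id]

/-- The coherence isomorphisms `G(αβ) ≅ Gα Gβ` are natural with respect to all squares. -/
theorem mapClass_hcomp_vcomp {a a' a'' c c' c'' : B.Obj} {α : a ⟶ a'} {α' : a' ⟶ a''}
    {β : c ⟶ c'} {β' : c' ⟶ c''} (φ : FormalSquare B α β) (ψ : FormalSquare B α' β')
    (h : φ.tgt = ψ.src) :
    vcomp (G.mapClass (.hcomp φ ψ h)) (cell (G.toPseudo.mapComp β β').hom) =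
      vcomp (cell (G.toPseudo.mapComp α α').hom)
        (hcomp (G.mapClass φ) (G.mapClass ψ) (G.mapClass_compatible h)) := by
  rw [mapClass_hcomp, vcomp_assoc, vcomp_assoc, cell_vcomp_cell, Iso.inv_hom_id, vcomp_cell_id]

theorem mapClass_exchange {a a' a'' c c' c'' e e' e'' : B.Obj} {α : a ⟶ a'} {α' : a' ⟶ a''}
    {β : c ⟶ c'} {β' : c' ⟶ c''} {γ : e ⟶ e'} {γ' : e' ⟶ e''}
    (φ₁ : FormalSquare B α β) (φ₂ : FormalSquare B β γ)
    (ψ₁ : FormalSquare B α' β') (ψ₂ : FormalSquare B β' γ')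
    (h₁ : φ₁.tgt = ψ₁.src) (h₂ : φ₂.tgt = ψ₂.src)
    (h : (FormalSquare.vcomp φ₁ φ₂).tgt = (FormalSquare.vcomp ψ₁ ψ₂).src) :
    G.mapClass (.hcomp (.vcomp φ₁ φ₂) (.vcomp ψ₁ ψ₂) h) =
      G.mapClass (.vcomp (.hcomp φ₁ ψ₁ h₁) (.hcomp φ₂ ψ₂ h₂)) := by
  simp only [mapClass_vcomp, mapClass_hcomp, vcomp_assoc, cell_inv_vcomp_cell_hom_vcomp]
  rw [hcomp_vcomp_vcomp _ _ _ _ (G.mapClass_compatible h₁) (G.mapClass_compatible h₂),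
    vcomp_assoc]

theorem mapClass_cell_hcomp {a b c : B.Obj} {α β : a ⟶ b} {α' β' : b ⟶ c} (η : α ⟶ β)
    (θ : α' ⟶ β') (h : (FormalSquare.cell η).tgt = (FormalSquare.cell θ).src) :
    G.mapClass (.hcomp (.cell η) (.cell θ) h) = G.mapClass (.cell (η ▷ α' ≫ β ◁ θ)) := by
  simp only [mapClass_hcomp, mapClass_cell]
  rw [cell_hcomp_cell, cell_vcomp_cell, cell_vcomp_cell]
  simp

theorem mapClass_leftUnitor {a b c d : B.Obj} {α : a ⟶ b} {β : c ⟶ d} (φ : FormalSquare B α β)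
    {f : B.VHom a c} (h : (FormalSquare.hid f).tgt = φ.src) :
    G.mapClass (.vcomp (.hcomp (.hid f) φ h) (.cell (λ_ β).hom)) =
      G.mapClass (.vcomp (.cell (λ_ α).hom) φ) := by
  have k : (hid (G.vmap f)).tgt = (G.mapClass φ).src :=
    (congrArg G.vmap h).trans (G.src_mapClass φ).symm
  simp only [mapClass_vcomp, mapClass_hcomp, mapClass_hid, mapClass_cell]
  rw [hcomp_cell_vcomp_vcomp_cell_left _ _ _ _ k]
  simp only [vcomp_assoc, cell_vcomp_cell, cell_vcomp_cell_vcomp, Category.assoc,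
    Pseudofunctor.map₂_left_unitor, Iso.inv_hom_id_assoc, inv_hom_whiskerRight_assoc]
  rw [leftUnitor_naturality, cell_vcomp_cell_vcomp]
  simp only [Category.assoc]

theorem mapClass_rightUnitor {a b c d : B.Obj} {α : a ⟶ b} {β : c ⟶ d} (φ : FormalSquare B α β)
    {f : B.VHom b d} (h : φ.tgt = (FormalSquare.hid f).src) :
    G.mapClass (.vcomp (.hcomp φ (.hid f) h) (.cell (ρ_ β).hom)) =
      G.mapClass (.vcomp (.cell (ρ_ α).hom) φ) := by
  have k : (G.mapClass φ).tgt = (hid (G.vmap f)).src :=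
    (G.tgt_mapClass φ).trans (congrArg G.vmap h)
  simp only [mapClass_vcomp, mapClass_hcomp, mapClass_hid, mapClass_cell]
  rw [hcomp_cell_vcomp_vcomp_cell_right _ _ _ _ k]
  simp only [vcomp_assoc, cell_vcomp_cell, cell_vcomp_cell_vcomp, Category.assoc,
    Pseudofunctor.map₂_right_unitor, Iso.inv_hom_id_assoc, whiskerLeft_inv_hom_assoc]
  rw [rightUnitor_naturality, cell_vcomp_cell_vcomp]
  simp only [Category.assoc]

theorem mapClass_associator {a b c d a' b' c' d' : B.Obj} {α : a ⟶ b} {β : b ⟶ c} {γ : c ⟶ d}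
    {α' : a' ⟶ b'} {β' : b' ⟶ c'} {γ' : c' ⟶ d'} (φ : FormalSquare B α α')
    (ψ : FormalSquare B β β') (χ : FormalSquare B γ γ') (h : φ.tgt = ψ.src)
    (h' : ψ.tgt = χ.src) (l : (FormalSquare.hcomp φ ψ h).tgt = χ.src)
    (l' : φ.tgt = (FormalSquare.hcomp ψ χ h').src) :
    G.mapClass (.vcomp (.hcomp (.hcomp φ ψ h) χ l) (.cell (α_ α' β' γ').hom)) =
      G.mapClass (.vcomp (.cell (α_ α β γ).hom) (.hcomp φ (.hcomp ψ χ h') l')) := by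
  have k : (hcomp (G.mapClass φ) (G.mapClass ψ) (G.mapClass_compatible h)).tgt =
      (G.mapClass χ).src :=
    (tgt_hcomp _ _ _).trans (G.mapClass_compatible h')
  have k' : (G.mapClass φ).tgt =
      (hcomp (G.mapClass ψ) (G.mapClass χ) (G.mapClass_compatible h')).src :=
    (G.mapClass_compatible h).trans (src_hcomp _ _ _).symm
  simp only [mapClass_vcomp, mapClass_hcomp, mapClass_cell]
  rw [hcomp_cell_vcomp_vcomp_cell_left _ _ _ _ k, hcomp_cell_vcomp_vcomp_cell_right _ _ _ _ k']
  simp only [vcomp_assoc, cell_vcomp_cell, cell_vcomp_cell_vcomp, Category.assoc,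
    Pseudofunctor.map₂_associator, Iso.inv_hom_id_assoc, inv_hom_whiskerRight_assoc,
    whiskerLeft_inv_hom, Category.comp_id]
  rw [← cell_vcomp_cell (α_ _ _ _).hom, ← vcomp_assoc (hcomp _ _ _),
    associator_naturality _ _ _ _ (G.mapClass_compatible h') k k']
  simp only [vcomp_assoc, cell_vcomp_cell_vcomp, Category.assoc]

/-- The map `Φ ↦ GΦ` on formal squares respects the congruence: the coherence 2-cells of `G`
inserted between two consecutive operations cancel, and the remaining ones are accounted for by the
coherence laws of the pseudofunctor. -/
theorem mapClass_eq_of_rel {a b c d : B.Obj} {α : a ⟶ b} {β : c ⟶ d} {φ ψ : FormalSquare B α β}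
    (h : FormalSquare.Rel φ ψ) : G.mapClass φ = G.mapClass ψ := by
  induction h with
  | refl => rfl
  | symm _ ih => exact ih.symm
  | trans _ _ ih ih' => exact ih.trans ih'
  | vcomp_congr _ _ ih ih' => exact congrArg₂ vcomp ih ih'
  | hcomp_congr h h' _ _ ih ih' =>
    rw [mapClass_hcomp, mapClass_hcomp,
      hcomp_congr ih ih' (G.mapClass_compatible h) (G.mapClass_compatible h')]
  | vid_vcomp φ => rw [mapClass_vcomp, mapClass_vid, FreeSquare.vid_vcomp]
  | vcomp_vid φ => rw [mapClass_vcomp, mapClass_vid, FreeSquare.vcomp_vid]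
  | vcomp_assoc φ ψ χ => simp only [mapClass_vcomp, FreeSquare.vcomp_assoc]
  | exchange φ₁ φ₂ ψ₁ ψ₂ h₁ h₂ h => exact G.mapClass_exchange φ₁ φ₂ ψ₁ ψ₂ h₁ h₂ h
  | cell_id α => rw [mapClass_cell, mapClass_vid, G.toPseudo.map₂_id, cell_id]
  | cell_comp η θ =>
    rw [mapClass_vcomp, mapClass_cell, mapClass_cell, mapClass_cell, cell_vcomp_cell,
      G.toPseudo.map₂_comp]
  | hid_id a =>
    rw [mapClass_hid, mapClass_vid, G.vmap_id, hid_vid, vid_vcomp, cell_vcomp_cell,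
      Iso.hom_inv_id, cell_id]
  | hid_comp f g =>
    simp only [mapClass_vcomp, mapClass_hid, G.vmap_comp, hid_vcomp, vcomp_assoc,
      cell_inv_vcomp_cell_hom_vcomp]
  | cell_hcomp η θ => exact G.mapClass_cell_hcomp η θ _
  | leftUnitor φ => exact G.mapClass_leftUnitor φ _
  | rightUnitor φ => exact G.mapClass_rightUnitor φ _
  | associator φ ψ χ h h' => exact G.mapClass_associator φ ψ χ h h' _ _

/-- The map induced by `Φ ↦ GΦ` on the squares of the free double categories. -/
def mapFreeSquare {a b c d : B.Obj} {α : a ⟶ b} {β : c ⟶ d} (φ : FreeSquare B α β) :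
    FreeSquare B' (G.toPseudo.map α) (G.toPseudo.map β) :=
  Quotient.lift G.mapClass (fun _ _ h => G.mapClass_eq_of_rel h) φ

end DecoratedPseudofunctor

/-! ### The induced double functor -/

namespace DecoratedPseudofunctor

open FreeSquare DoubleCategoryData DecoratedBicategory

variable {B : DecoratedBicategory.{w, v, x, u}} {B' : DecoratedBicategory.{w', v', x', u'}}
  (G : DecoratedPseudofunctor B B')

/-- Compatibility of `G` with associators, with the coherence isomorphisms on the sides where a double
functor requires them, as an equality of globular squares. -/
theorem freeGlob_map₂_associator {a b c d : B.Obj} (α : a ⟶ b) (β : b ⟶ c) (γ : c ⟶ d) :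
    freeGlob (G.toPseudo.map₂ (α_ α β γ).hom ≫ (G.toPseudo.mapComp α (β ≫ γ)).hom ≫
        G.toPseudo.map α ◁ (G.toPseudo.mapComp β γ).hom) =
      freeGlob ((G.toPseudo.mapComp (α ≫ β) γ).hom ≫
        (G.toPseudo.mapComp α β).hom ▷ G.toPseudo.map γ ≫
        (α_ (G.toPseudo.map α) (G.toPseudo.map β) (G.toPseudo.map γ)).hom) := by
  simp

/-- The double functor induced by a decorated pseudofunctor on the free globularly generated double
categories. -/
def mapFree : DoubleFunctor B.free B'.free where
  obj a := G.toPseudo.obj a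
  vmap f := G.vmap f
  vmap_id a := G.vmap_id a
  vmap_comp f g := G.vmap_comp f g
  hmap α := G.toPseudo.map α
  sqmap φ := G.mapFreeSquare φ
  src_sqmap := by rintro _ _ _ _ _ _ ⟨φ⟩; exact G.src_mapClass φ
  tgt_sqmap := by rintro _ _ _ _ _ _ ⟨φ⟩; exact G.tgt_mapClass φ
  sqmap_vidSq _ := rfl
  sqmap_vcompSq := by rintro _ _ _ _ _ _ _ _ _ ⟨φ⟩ ⟨ψ⟩; rfl
  mapId a := freeGlobIso (G.toPseudo.mapId a)
  mapComp α β := freeGlobIso (G.toPseudo.mapComp α β)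
  mapId_naturality f := G.mapClass_hid_vcomp f
  mapComp_naturality := by
    rintro _ _ _ _ _ _ _ _ _ _ ⟨φ⟩ ⟨ψ⟩ h; exact G.mapClass_hcomp_vcomp φ ψ h
  map_associator α β γ := by
    have h := congrArg Glob.sq (G.freeGlob_map₂_associator α β γ)
    simp only [freeGlob_comp, freeGlob_whiskerLeft, freeGlob_whiskerRight] at h
    exact h
  map_leftUnitor {a b} α := by
    have h := congrArg (fun η => (freeGlob η).sq) (G.toPseudo.map₂_left_unitor α)
    simp only [freeGlob_comp, freeGlob_whiskerRight] at h
    exact h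
  map_rightUnitor {a b} α := by
    have h := congrArg (fun η => (freeGlob η).sq) (G.toPseudo.map₂_right_unitor α)
    simp only [freeGlob_comp, freeGlob_whiskerLeft] at h
    exact h

/-- Decorated pseudofunctors with the same underlying prelax functor and vertical functor agree if
their coherence isomorphisms have the same components. -/
theorem ext_of_toPrelaxFunctor_eq {F F' : DecoratedPseudofunctor B B'}
    (h : F.toPseudo.toPrelaxFunctor = F'.toPseudo.toPrelaxFunctor)
    (hv : ∀ {a b : B.Obj} (f : B.VHom a b), F.vmap f ≍ F'.vmap f)
    (hi : ∀ a, (F.toPseudo.mapId a).hom ≍ (F'.toPseudo.mapId a).hom)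
    (hc : ∀ {a b c : B.Obj} (α : a ⟶ b) (β : b ⟶ c),
      (F.toPseudo.mapComp α β).hom ≍ (F'.toPseudo.mapComp α β).hom) : F = F' := by
  obtain ⟨⟨P, i, m, _, _, _, _, _⟩, f, _, _⟩ := F
  obtain ⟨⟨P', i', m', _, _, _, _, _⟩, f', _, _⟩ := F'
  obtain rfl : P = P' := h
  obtain rfl : i = i' := funext fun a => Iso.ext (eq_of_heq (hi a))
  obtain rfl : @m = @m' := by
    funext a b c α β
    exact Iso.ext (eq_of_heq (hc α β))
  obtain rfl : @f = @f' := by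
    funext a b g
    exact eq_of_heq (hv g)
  rfl

theorem inclusion_comp_mapFree :
    B.inclusion.comp G.mapFree.horizontalization = G.comp B'.inclusion := by
  refine ext_of_toPrelaxFunctor_eq rfl (fun _ => HEq.rfl) (fun a => heq_of_eq ?_)
    (fun α β => heq_of_eq ?_)
  · refine glob_ext (C := B'.freeData) ?_
    exact (FreeSquare.vid_vcomp (cell (G.toPseudo.mapId a).hom)).trans
      (FreeSquare.vcomp_vid _).symm
  · refine glob_ext (C := B'.freeData) ?_
    exact (FreeSquare.vid_vcomp (cell (G.toPseudo.mapComp α β).hom)).trans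
      (FreeSquare.vcomp_vid _).symm

end DecoratedPseudofunctor

/-! ### Double functors out of the free double category -/

namespace DoubleFunctor

open DoubleCategoryData DecoratedBicategory

variable {B : DecoratedBicategory.{w, v, x, u}} {D : DoubleCategory.{v', x', u', s'}}

/-- The inclusion has identity coherence 2-cells, so it contributes nothing to the coherence of a
composite with it. -/
theorem inclusion_comp_mapId_hom (F : DoubleFunctor B.free D) (a : B.Obj) :
    ((B.inclusion.comp F.horizontalization).toPseudo.mapId a).hom = (F.mapId a).hom :=
  (congrArg (fun η => D.data.globVcomp η (F.mapId a).hom) (F.globMap_id _)).trans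
    (id_globVcomp _)

theorem inclusion_comp_mapComp_hom (F : DoubleFunctor B.free D) {a b c : B.Obj} (α : a ⟶ b)
    (β : b ⟶ c) :
    ((B.inclusion.comp F.horizontalization).toPseudo.mapComp α β).hom = (F.mapComp α β).hom :=
  (congrArg (fun η => D.data.globVcomp η (F.mapComp α β).hom) (F.globMap_id _)).trans
    (id_globVcomp _)

/-- A globular isomorphism can be cancelled below a square. -/
theorem vcompSq_iso_hom_cancel {C : DoubleCategoryData.{v, x, u, s}} {a b c d : C.Obj}
    {α : C.Hor a b} {β γ : C.Hor c d} {φ ψ : C.Sq α β} (e : β ≅ γ)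
    (h : C.vcompSq φ e.hom.sq = C.vcompSq ψ e.hom.sq) : φ = ψ := by
  have h' := congrArg (fun t => C.vcompSq t e.inv.sq) h
  have k : C.vcompSq e.hom.sq e.inv.sq = C.vidSq β := congrArg Glob.sq e.hom_inv_id
  simpa only [C.vcompSq_assoc, k, C.vcompSq_vidSq] using h'

/-- A double functor out of the free globularly generated double category is determined by its
restriction to the decorated bicategory. The restriction records the coherence isomorphisms and the
values on 2-cells; naturality of the coherence isomorphisms then forces the values on formal
horizontal identities and on horizontal composites, so two such double functors agree on all formal
squares by induction. -/
theorem eq_of_inclusion_comp_eq {F F' : DoubleFunctor B.free D}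
    (h : B.inclusion.comp F.horizontalization = B.inclusion.comp F'.horizontalization) :
    F = F' := by
  have hobj : F.obj = F'.obj :=
    congrArg (fun P : DecoratedPseudofunctor B D.horizontalization => P.toPseudo.obj) h
  have hvmap : @F.vmap ≍ @F'.vmap :=
    congr_arg_heq (fun P : DecoratedPseudofunctor B D.horizontalization => @P.vmap) h
  have hhmap : @F.hmap ≍ @F'.hmap :=
    congr_arg_heq (fun (P : DecoratedPseudofunctor B D.horizontalization) (a b : B.Obj)
      (α : a ⟶ b) => P.toPseudo.map α) h
  have hcell : (fun (a b : B.Obj) (α β : a ⟶ b) (η : α ⟶ β) => F.globMap (freeGlob η)) ≍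
      (fun (a b : B.Obj) (α β : a ⟶ b) (η : α ⟶ β) => F'.globMap (freeGlob η)) :=
    congr_arg_heq (fun (P : DecoratedPseudofunctor B D.horizontalization) (a b : B.Obj)
      (α β : a ⟶ b) (η : α ⟶ β) => P.toPseudo.map₂ η) h
  have hmapId : (fun a : B.Obj => (F.mapId a).hom) ≍ (fun a : B.Obj => (F'.mapId a).hom) := by
    simp only [← inclusion_comp_mapId_hom]
    exact congr_arg_heq (fun (P : DecoratedPseudofunctor B D.horizontalization) (a : B.Obj) =>
      (P.toPseudo.mapId a).hom) h
  have hmapComp : (fun (a b c : B.Obj) (α : a ⟶ b) (β : b ⟶ c) => (F.mapComp α β).hom) ≍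
      (fun (a b c : B.Obj) (α : a ⟶ b) (β : b ⟶ c) => (F'.mapComp α β).hom) := by
    simp only [← inclusion_comp_mapComp_hom]
    exact congr_arg_heq (fun (P : DecoratedPseudofunctor B D.horizontalization) (a b c : B.Obj)
      (α : a ⟶ b) (β : b ⟶ c) => (P.toPseudo.mapComp α β).hom) h
  clear h
  -- After identifying the object maps the remaining heterogeneous equalities become homogeneous
  -- one field at a time.
  obtain ⟨obj, vmap, _, _, hmap, sqmap, _, _, vidSq, vcompSq, mapId, mapComp, natId, natComp,
    _, _, _⟩ := F
  obtain ⟨obj', vmap', _, _, hmap', sqmap', _, _, vidSq', vcompSq', mapId', mapComp', natId',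
    natComp', _, _, _⟩ := F'
  obtain rfl : obj = obj' := hobj
  obtain rfl : @vmap = @vmap' := eq_of_heq hvmap
  obtain rfl : @hmap = @hmap' := eq_of_heq hhmap
  obtain rfl : @mapId = @mapId' :=
    funext fun a => Iso.ext (congrFun (eq_of_heq hmapId) a)
  obtain rfl : @mapComp = @mapComp' := by
    funext a b c α β
    exact Iso.ext (congrFun (congrFun (congrFun (congrFun (congrFun
      (eq_of_heq hmapComp) a) b) c) α) β)
  have hcell' {a b : B.Obj} {α β : a ⟶ b} (η : α ⟶ β) :
      sqmap (FreeSquare.cell η) = sqmap' (FreeSquare.cell η) :=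
    congrArg Glob.sq (congrFun (congrFun (congrFun (congrFun (congrFun
      (eq_of_heq hcell) a) b) α) β) η)
  have key {a b c d : B.Obj} {α : a ⟶ b} {β : c ⟶ d} (φ : PreSquare B α β) (hφ : φ.WF) :
      sqmap (FreeSquare.mk ⟨φ, hφ⟩) = sqmap' (FreeSquare.mk ⟨φ, hφ⟩) := by
    induction φ with
    | cell η => exact hcell' η
    | hid f => exact vcompSq_iso_hom_cancel (mapId _) ((natId f).trans (natId' f).symm)
    | vid α => exact (vidSq α).trans (vidSq' α).symm
    | vcomp φ ψ ih ih' =>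
      exact (vcompSq (FreeSquare.mk ⟨φ, hφ.1⟩) (FreeSquare.mk ⟨ψ, hφ.2⟩)).trans
        ((congrArg₂ D.data.vcompSq (ih hφ.1) (ih' hφ.2)).trans
          (vcompSq' (FreeSquare.mk ⟨φ, hφ.1⟩) (FreeSquare.mk ⟨ψ, hφ.2⟩)).symm)
    | hcomp φ ψ ih ih' =>
      refine vcompSq_iso_hom_cancel (mapComp _ _)
        ((natComp (FreeSquare.mk ⟨φ, hφ.1⟩) (FreeSquare.mk ⟨ψ, hφ.2.1⟩) hφ.2.2).trans
          (Eq.trans ?_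
            (natComp' (FreeSquare.mk ⟨φ, hφ.1⟩) (FreeSquare.mk ⟨ψ, hφ.2.1⟩) hφ.2.2).symm))
      simp only [ih hφ.1, ih' hφ.2.1]
  obtain rfl : @sqmap = @sqmap' := by
    funext a b c d α β φ
    obtain ⟨φ, hφ⟩ := φ
    exact key φ hφ
  rfl

end DoubleFunctor

/-! ### Compatibility with the vertical filtration -/

namespace FreeSquare

variable {B : DecoratedBicategory.{w, v, x, u}}

/-- A square of the free double category is conjugate to `P` if it is obtained from the class of a
formal square satisfying `P` by pasting a 2-cell above and a 2-cell below. The 2-cells need not be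
invertible. -/
def IsConjugate
    (P : ∀ ⦃a b c d : B.Obj⦄ ⦃α : a ⟶ b⦄ ⦃β : c ⟶ d⦄, FormalSquare B α β → Prop)
    {a b c d : B.Obj} {α : a ⟶ b} {β : c ⟶ d} (σ : FreeSquare B α β) : Prop :=
  ∃ (γ : a ⟶ b) (δ : c ⟶ d) (η : α ⟶ γ) (φ : FormalSquare B γ δ) (θ : δ ⟶ β),
    P φ ∧ σ = vcomp (cell η) (vcomp (mk φ) (cell θ))

theorem isConjugate_mk
    {P : ∀ ⦃a b c d : B.Obj⦄ ⦃α : a ⟶ b⦄ ⦃β : c ⟶ d⦄, FormalSquare B α β → Prop}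
    {a b c d : B.Obj} {α : a ⟶ b} {β : c ⟶ d} {φ : FormalSquare B α β} (h : P φ) :
    IsConjugate P (mk φ) :=
  ⟨_, _, 𝟙 _, φ, 𝟙 _, h, by rw [vcomp_cell_id, cell_id_vcomp]⟩

theorem IsConjugate.vcomp_cell
    {P : ∀ ⦃a b c d : B.Obj⦄ ⦃α : a ⟶ b⦄ ⦃β : c ⟶ d⦄, FormalSquare B α β → Prop}
    {a b c d : B.Obj} {α α' : a ⟶ b} {β β' : c ⟶ d} {σ : FreeSquare B α β}
    (h : IsConjugate P σ) (η : α' ⟶ α) (θ : β ⟶ β') :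
    IsConjugate P (vcomp (cell η) (vcomp σ (cell θ))) := by
  obtain ⟨γ, δ, η', φ, θ', hφ, rfl⟩ := h
  exact ⟨γ, δ, η ≫ η', φ, θ' ≫ θ, hφ, by
    simp only [vcomp_assoc, cell_vcomp_cell, cell_vcomp_cell_vcomp]⟩

/-- Horizontal composites of conjugates of horizontal words are conjugates of horizontal words, by
the exchange law. -/
theorem IsConjugate.hcomp
    {P : ∀ ⦃a b c d : B.Obj⦄ ⦃α : a ⟶ b⦄ ⦃β : c ⟶ d⦄, FormalSquare B α β → Prop}
    {a a' a'' c c' c'' : B.Obj} {α : a ⟶ a'} {α' : a' ⟶ a''} {β : c ⟶ c'} {β' : c' ⟶ c''}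
    {σ : FreeSquare B α β} {τ : FreeSquare B α' β'} (hσ : IsConjugate (FormalSquare.HWord P) σ)
    (hτ : IsConjugate (FormalSquare.HWord P) τ) (h : σ.tgt = τ.src) :
    IsConjugate (FormalSquare.HWord P) (hcomp σ τ h) := by
  obtain ⟨γ, δ, η, φ, θ, hφ, rfl⟩ := hσ
  obtain ⟨γ', δ', η', ψ, θ', hψ, rfl⟩ := hτ
  have k : (mk φ).tgt = (mk ψ).src :=
    (tgt_cell_vcomp_vcomp_cell η (mk φ) θ).symm.trans
      (h.trans (src_cell_vcomp_vcomp_cell η' (mk ψ) θ'))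
  exact ⟨_, _, _, FormalSquare.hcomp φ ψ k, _, .hcomp φ ψ k hφ hψ,
    hcomp_cell_vcomp_vcomp_cell η (mk φ) θ η' (mk ψ) θ' k h⟩

end FreeSquare

namespace FormalSquare

variable {B : DecoratedBicategory.{w, v, x, u}}

theorem inE_cell (k : ℕ) {a b : B.Obj} {α β : a ⟶ b} (η : α ⟶ β) : InE k (cell η) := by
  induction k with
  | zero => exact .of _ (.cell η)
  | succ k ih => exact .of _ (.of _ ih)

end FormalSquare

namespace DecoratedPseudofunctor

open FreeSquare FormalSquare

variable {B : DecoratedBicategory.{w, v, x, u}} {B' : DecoratedBicategory.{w', v', x', u'}}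
  (G : DecoratedPseudofunctor B B')
  {P : ∀ ⦃a b c d : B.Obj⦄ ⦃α : a ⟶ b⦄ ⦃β : c ⟶ d⦄, FormalSquare B α β → Prop}
  {P' : ∀ ⦃a b c d : B'.Obj⦄ ⦃α : a ⟶ b⦄ ⦃β : c ⟶ d⦄, FormalSquare B' α β → Prop}

theorem isConjugate_mapClass_of_isGenerator {a b c d : B.Obj} {α : a ⟶ b} {β : c ⟶ d}
    {φ : FormalSquare B α β} (h : IsGenerator φ) :
    IsConjugate (HWord IsGenerator) (G.mapClass φ) := by
  cases h with
  | cell η => exact isConjugate_mk (.of _ (.cell _))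
  | hid f => exact ⟨_, _, _, .hid (G.vmap f), _, .of _ (.hid _), rfl⟩

/-- If the images of the squares satisfying `P` are conjugate to horizontal words, then so are the
images of horizontal words in such squares: the 2-cells around the factors of a horizontal composite
are absorbed in the coherence 2-cells of `G`. -/
theorem isConjugate_mapClass_of_hWord
    (hP : ∀ {a b c d : B.Obj} {α : a ⟶ b} {β : c ⟶ d} {φ : FormalSquare B α β}, P φ →
      IsConjugate (HWord P') (G.mapClass φ))
    {a b c d : B.Obj} {α : a ⟶ b} {β : c ⟶ d} {φ : FormalSquare B α β} (h : HWord P φ) :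
    IsConjugate (HWord P') (G.mapClass φ) := by
  induction h with
  | of φ h => exact hP h
  | hcomp φ ψ h _ _ ih ih' =>
    exact (IsConjugate.hcomp ih ih' (G.mapClass_compatible h)).vcomp_cell _ _

theorem exists_vPath_of_vPath
    (hP : ∀ {a b c d : B.Obj} {α : a ⟶ b} {β : c ⟶ d} {φ : FormalSquare B α β}, P φ →
      ∃ φ', VPath P' φ' ∧ G.mapClass φ = FreeSquare.mk φ')
    {a b c d : B.Obj} {α : a ⟶ b} {β : c ⟶ d} {φ : FormalSquare B α β} (h : VPath P φ) :
    ∃ φ', VPath P' φ' ∧ G.mapClass φ = FreeSquare.mk φ' := by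
  induction h with
  | of φ h => exact hP h
  | vid α => exact ⟨_, .vid _, rfl⟩
  | vcomp φ ψ _ _ ih ih' =>
    obtain ⟨φ', hφ, eφ⟩ := ih
    obtain ⟨ψ', hψ, eψ⟩ := ih'
    exact ⟨_, .vcomp φ' ψ' hφ hψ, congrArg₂ FreeSquare.vcomp eφ eψ⟩

theorem exists_inF_of_isConjugate {k : ℕ} {a b c d : B'.Obj} {α : a ⟶ b} {β : c ⟶ d}
    {σ : FreeSquare B' α β} (h : IsConjugate (InE k) σ) : ∃ φ, InF k φ ∧ σ = FreeSquare.mk φ := by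
  obtain ⟨γ, δ, η, φ, θ, hφ, rfl⟩ := h
  exact ⟨_, .vcomp _ _ (.of _ (inE_cell k η)) (.vcomp _ _ (.of _ hφ) (.of _ (inE_cell k θ))), rfl⟩

/-- The image of a formal square in `E_k` is represented by a square in `E_k` up to 2-cells pasted
above and below. Those 2-cells lie in `E_k` themselves, so the image of a vertical composite of
squares in `E_k` is represented by a vertical composite of squares in `E_k`, and the claim for
`E_{k+1}` follows. -/
theorem isConjugate_mapClass_of_inE {k : ℕ} {a b c d : B.Obj} {α : a ⟶ b} {β : c ⟶ d}
    {φ : FormalSquare B α β} (h : InE k φ) : IsConjugate (InE k) (G.mapClass φ) := by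
  induction k generalizing a b c d with
  | zero => exact G.isConjugate_mapClass_of_hWord G.isConjugate_mapClass_of_isGenerator h
  | succ k ih =>
    refine G.isConjugate_mapClass_of_hWord (fun hψ => ?_) h
    obtain ⟨ψ', hψ', e⟩ :=
      G.exists_vPath_of_vPath (fun hχ => exists_inF_of_isConjugate (ih hχ)) hψ
    rw [e]
    exact isConjugate_mk (.of _ hψ')

theorem exists_inF_of_inF {k : ℕ} {a b c d : B.Obj} {α : a ⟶ b} {β : c ⟶ d}
    {φ : FormalSquare B α β} (h : InF k φ) : ∃ φ', InF k φ' ∧ G.mapClass φ = FreeSquare.mk φ' :=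
  G.exists_vPath_of_vPath
    (fun hψ => exists_inF_of_isConjugate (G.isConjugate_mapClass_of_inE hψ)) h

theorem mapSquare_mapFree_mem_freeVertical {k : ℕ} {σ : B.free.data.Square}
    (h : σ ∈ B.freeVertical k) : G.mapFree.mapSquare σ ∈ B'.freeVertical k := by
  obtain ⟨a, b, c, d, α, β, φ, hφ, rfl⟩ := h
  obtain ⟨φ', hφ', e⟩ := G.exists_inF_of_inF hφ
  exact ⟨_, _, _, _, _, _, φ', hφ', congrArg (fun τ => (⟨τ⟩ : B'.free.data.Square)) e⟩

end DecoratedPseudofunctor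

end DoubleCats

theorem mainTheorem2 (B : DoubleCats.DecoratedBicategory.{w, v, x, u})
    (B' : DoubleCats.DecoratedBicategory.{w', v', x', u'})
    (G : DoubleCats.DecoratedPseudofunctor B B') :
    ∃ Q : DoubleCats.DoubleFunctor B.free B'.free,
      B.inclusion.comp Q.horizontalization = G.comp B'.inclusion ∧
      (∀ Q' : DoubleCats.DoubleFunctor B.free B'.free,
        B.inclusion.comp Q'.horizontalization = G.comp B'.inclusion → Q' = Q) ∧
      (∀ {a b c d : B.Obj} {α : a ⟶ b} {β : c ⟶ d} (φ : DoubleCats.FormalSquare B α β),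
        Q.mapSquare (DoubleCats.DecoratedBicategory.freeSquare φ) =
          DoubleCats.DecoratedBicategory.freeSquare (G.mapFormal φ)) ∧
      (∀ k : ℕ, ∀ σ ∈ B.freeVertical k, Q.mapSquare σ ∈ B'.freeVertical k) :=
  ⟨G.mapFree, G.inclusion_comp_mapFree,
    fun _ h => DoubleCats.DoubleFunctor.eq_of_inclusion_comp_eq
      (h.trans G.inclusion_comp_mapFree.symm),
    fun _ => rfl, fun _ _ h => G.mapSquare_mapFree_mem_freeVertical h⟩
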